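/- Let $d\ge 1$, $L\ge 0$, $M\ge 0$ be integers. An observation is a pair $(h,C)$ with $h\in\mathbb R^d$ and $C\in\mathbb R^{d\times L}$ with columns $c_1,\dots,c_L$, identified with the stacked vector $x=[h;\mathrm{vec}(C)]\in\mathbb R^{d(L+1)}$. Given $\theta=(\eta,\Lambda)$ with $\Lambda$ symmetric positive definite, let $(h,C)$ be Gaussian, $$p(h,C\mid\theta)=\mathcal N\big([h;\mathrm{vec}(C)]\,\big|\,\mu=\Lambda^{-1}\eta,\ \Sigma=\Lambda^{-1}\big),$$ and let $A(\eta,\Lambda)=\log\int \exp(\eta^Tx-\tfrac12x^T\Lambda x)\,dx$ be its log-partition function. Let $\theta$ have the Normal-Wishart prior with Lebesgue density on $\{(\eta,\Lambda):\Lambda\succ0\}$ $$p(\eta,\Lambda)\ \propto\ \exp\big(t_0^T\eta-\tfrac12\operatorname{tr}(V_0^T\Lambda)-n_0A(\eta,\Lambda)\big),$$ where $n_0>0$, $t_0$ is a vector, the right-hand side has finite integral (so that the prior is a probability distribution), and $V_0$ is an arbitrary block matrix with $d\times d$ blocks of the form $$V_0=\begin{bmatrix}V_{hh}&V_{hc_1}^T&\cdots&V_{hc_L}^T\\V_{hc_1}&V_{c_1c_1}&\cdots&V_{c_Lc_1}^T\\\vdots&\vdots&\ddots&\vdots\\V_{hc_L}&V_{c_Lc_1}&\cdots&V_{c_Lc_L}\end{bmatrix}.$$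 Let $\mathcal D=(h_1,C_1,\dots,h_M,C_M)$ and a further observation $(h,C)$ be conditionally i.i.d. given $\theta$. A decision rule is a measurable function $\alpha$ of $\mathcal D$ with values in $\mathbb R^L$; its Bayesian regret is $$\mathbb E_\theta\,\mathbb E_{\mathcal D\mid\theta}\,L(\alpha(\mathcal D),\theta),\qquad L(a,\theta)=\mathbb E_{h,C\mid\theta}\|h+Ca\|^2 .$$ Then the entries of $C^TC$ and $C^Th$ are integrable, $\mathbb E[C^TC\mid\mathcal D]$ is almost surely invertible, a decision rule minimizing the Bayesian regret exists, and a decision rule $a^*$ minimizes it if and only if, almost surely, $$a^*(\mathcal D)=-\,\mathbb E[C^TC\mid\mathcal D]^{-1}\,\mathbb E[C^Th\mid\mathcal D].$$ Moreover, with $\kappa=n_0/(n_0+M)$, almost surely $$\mathbb E[C^Th\mid\mathcal D]=\frac{\kappa}{n_0}\begin{bmatrix}\operatorname{tr}V_{hc_1}\\\vdots\\\operatorname{tr}V_{hc_L}\end{bmatrix}+(1-\kappa)\,\overline{C^Th},\qquad \mathbb E[C^TC\mid\mathcal D]=\frac{\kappa}{n_0}\,T+(1-\kappa)\,\overline{C^TC},$$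 where $T$ is the symmetric $L\times L$ matrix with $T_{lk}=T_{kl}=\operatorname{tr}V_{c_lc_k}$ for $l\ge k$, and $\overline{C^TC}=\frac1M\sum_{m=1}^MC_m^TC_m$, $\overline{C^Th}=\frac1M\sum_{m=1}^MC_m^Th_m$ are the empirical averages (read as $0$ if $M=0$). -/

import Mathlib

open MeasureTheory ProbabilityTheory Matrix
open scoped ENNReal

namespace BayesCV

noncomputable section

/-! ### Gaussian likelihood and Normal-Wishart prior -/

/-- Canonical parameters `(η, Λ)` of a Gaussian on `ℝ^ι`. The symmetric matrix `Λ` is given by its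
free entries, one for each unordered pair of indices, so that the Lebesgue measure `volume` on this
space is the usual Lebesgue measure on pairs (vector, symmetric matrix). -/
abbrev Param (ι : Type*) : Type _ := (ι → ℝ) × (Sym2 ι → ℝ)

/-- The vector `η`. -/
def Param.eta {ι : Type*} (θ : Param ι) : ι → ℝ := θ.1

/-- The symmetric matrix `Λ`. -/
def Param.Lam {ι : Type*} (θ : Param ι) : Matrix ι ι ℝ := Matrix.of fun i j => θ.2 s(i, j)

variable {ι : Type*} [Fintype ι] [DecidableEq ι]

/-- The likelihood of one observation: the Gaussian with mean `Λ⁻¹ η` and covariance `Λ⁻¹`. -/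
def likelihood (θ : Param ι) : Measure (EuclideanSpace ℝ ι) :=
  multivariateGaussian (WithLp.toLp 2 (θ.Lam⁻¹ *ᵥ θ.eta)) θ.Lam⁻¹

/-- The log-partition function `A(η, Λ) = log ∫ exp (ηᵀ x - xᵀ Λ x / 2) dx` of the Gaussian family
in the canonical parameters `(η, Λ)`. -/
def logPartition (θ : Param ι) : ℝ :=
  Real.log (∫ x : ι → ℝ, Real.exp (θ.eta ⬝ᵥ x - (x ⬝ᵥ θ.Lam *ᵥ x) / 2))

/-- The unnormalized Normal-Wishart prior: the measure on `{(η, Λ) : Λ positive definite}` with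
Lebesgue density `exp (t₀ᵀ η - tr (Wᵀ Λ) - n₀ A(η, Λ))`. -/
def priorKernel (t₀ : ι → ℝ) (W : Matrix ι ι ℝ) (n₀ : ℝ) : Measure (Param ι) :=
  (volume.restrict {θ : Param ι | θ.Lam.PosDef}).withDensity fun θ =>
    ENNReal.ofReal (Real.exp (t₀ ⬝ᵥ θ.eta - (Wᵀ * θ.Lam).trace - n₀ * logPartition θ))

/-- The Normal-Wishart prior, normalized to total mass one. -/
def prior (t₀ : ι → ℝ) (W : Matrix ι ι ℝ) (n₀ : ℝ) : Measure (Param ι) :=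
  (priorKernel t₀ W n₀ Set.univ)⁻¹ • priorKernel t₀ W n₀

/-- The joint law of the data `x₁, …, x_M` and a new observation `x`, when `θ` has law `π` and the
`M + 1` observations are, given `θ`, independent with law `likelihood θ`. -/
def dataLaw (M : ℕ) (π : Measure (Param ι)) :
    Measure ((Fin M → EuclideanSpace ℝ ι) × EuclideanSpace ℝ ι) :=
  π.bind fun θ => (Measure.pi fun _ : Fin M => likelihood θ).prod (likelihood θ)

/-- The σ-algebra generated by the data `x₁, …, x_M`. -/
abbrev dataSigma (ι : Type*) [Fintype ι] (M : ℕ) :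
    MeasurableSpace ((Fin M → EuclideanSpace ℝ ι) × EuclideanSpace ℝ ι) :=
  MeasurableSpace.comap Prod.fst inferInstance

/-! ### Gradients and control variates -/

/-- Indices of the stacked vector `[h, vec(C)]`, for `h ∈ ℝ^d` and `C ∈ ℝ^{d × L}`; the index
`(l, i)` of `vec(C)` belongs to the `i`-th entry of the `l`-th column of `C`. -/
abbrev Idx (d L : ℕ) : Type := Fin d ⊕ (Fin L × Fin d)

/-- An observation `(h, C)`, stored as the stacked vector `[h, vec(C)]`. -/
abbrev Obs (d L : ℕ) : Type := EuclideanSpace ℝ (Idx d L)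

variable {d L M : ℕ}

/-- The gradient estimate `h` of an observation. -/
def Obs.h (x : Obs d L) : Fin d → ℝ := fun i => x (Sum.inl i)

/-- The matrix `C` of an observation, whose columns are the control variates. -/
def Obs.C (x : Obs d L) : Matrix (Fin d) (Fin L) ℝ := Matrix.of fun i l => x (Sum.inr (l, i))

theorem Obs.eq_stack (x : Obs d L) :
    x = WithLp.toLp 2 (Sum.elim (Obs.h x) (Matrix.vec (Obs.C x))) := by
  ext i
  rcases i with i | ⟨l, i⟩ <;> rfl

/-- The block `V_{h c_l}` (row index in `c_l`, column index in `h`). -/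
def blockHC (V : Matrix (Idx d L) (Idx d L) ℝ) (l : Fin L) : Matrix (Fin d) (Fin d) ℝ :=
  V.submatrix (fun i => Sum.inr (l, i)) Sum.inl

/-- The block `V_{c_l c_k}` (row index in `c_l`, column index in `c_k`). -/
def blockCC (V : Matrix (Idx d L) (Idx d L) ℝ) (l k : Fin L) : Matrix (Fin d) (Fin d) ℝ :=
  V.submatrix (fun i => Sum.inr (l, i)) (fun j => Sum.inr (k, j))

/-- `V` has the block form with `V_{h c_l}ᵀ` above and `V_{h c_l}` below the diagonal in the row
and column of `h`, and `V_{c_l c_k}ᵀ` above and `V_{c_l c_k}` below the diagonal elsewhere. -/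
def HasBlockForm (V : Matrix (Idx d L) (Idx d L) ℝ) : Prop :=
  (∀ l : Fin L, V.submatrix Sum.inl (fun i => Sum.inr (l, i)) = (blockHC V l)ᵀ) ∧
  (∀ l k : Fin L, k < l → blockCC V k l = (blockCC V l k)ᵀ)

/-- The empirical average of `Cᵀ C`. -/
def empCC (D : Fin M → Obs d L) : Matrix (Fin L) (Fin L) ℝ :=
  (M : ℝ)⁻¹ • ∑ m, (Obs.C (D m))ᵀ * Obs.C (D m)

/-- The empirical average of `Cᵀ h`. -/
def empCh (D : Fin M → Obs d L) : Fin L → ℝ :=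
  (M : ℝ)⁻¹ • ∑ m, (Obs.C (D m))ᵀ *ᵥ Obs.h (D m)

/-- The posterior expectation `E[Cᵀ C | h₁, C₁, …, h_M, C_M]` (entrywise conditional expectation
given the data, for the new observation). -/
def postCC (M : ℕ) (π : Measure (Param (Idx d L))) (ω : (Fin M → Obs d L) × Obs d L) :
    Matrix (Fin L) (Fin L) ℝ :=
  Matrix.of fun l k =>
    (dataLaw M π)[fun ω' => ((Obs.C ω'.2)ᵀ * Obs.C ω'.2) l k | dataSigma (Idx d L) M] ω

/-- The posterior expectation `E[Cᵀ h | h₁, C₁, …, h_M, C_M]`. -/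
def postCh (M : ℕ) (π : Measure (Param (Idx d L))) (ω : (Fin M → Obs d L) × Obs d L) :
    Fin L → ℝ :=
  fun l => (dataLaw M π)[fun ω' => ((Obs.C ω'.2)ᵀ *ᵥ Obs.h ω'.2) l | dataSigma (Idx d L) M] ω

/-! ### Bayesian regret -/

/-- The loss `L(a, θ) = E_{C, h | θ} ‖h + C a‖²` (Euclidean norm). -/
def loss (a : Fin L → ℝ) (θ : Param (Idx d L)) : ℝ≥0∞ :=
  ∫⁻ x, ‖WithLp.toLp 2 (Obs.h x + Obs.C x *ᵥ a)‖ₑ ^ 2 ∂(likelihood θ)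

/-- The Bayesian regret `E_θ E_{C₁, h₁, …, C_M, h_M | θ} L(δ(C₁, h₁, …, C_M, h_M), θ)`. -/
def bayesRegret (π : Measure (Param (Idx d L))) (δ : (Fin M → Obs d L) → (Fin L → ℝ)) : ℝ≥0∞ :=
  ∫⁻ θ, ∫⁻ D, loss (δ D) θ ∂(Measure.pi fun _ : Fin M => likelihood θ) ∂π

/-- `δ` is a (measurable) decision rule that minimizes the Bayesian regret. -/
def IsOptimalRule (π : Measure (Param (Idx d L))) (δ : (Fin M → Obs d L) → (Fin L → ℝ)) : Prop :=
  Measurable δ ∧ ∀ δ' : (Fin M → Obs d L) → (Fin L → ℝ), Measurable δ' →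
    bayesRegret π δ ≤ bayesRegret π δ'

end

end BayesCV

namespace BayesCV

/-! ### One-dimensional slices -/

/-! The `i`-th entry of `h + C a` is a linear form `uᵀx` of the observation, so everything rests on
one formula: for a proper prior with parameters `(t₀, W, n₀)`, the prior mean of `E[(uᵀx)² | θ] =
uᵀΛ⁻¹u + (uᵀΛ⁻¹η)²` is `2 uᵀWu / n₀` (`lintegral_secondMoment_priorKernel`).

For its proof, the parameter space is cut into lines `θ + s (0, uuᵀ)`. Let `τ` be `s` counted from
the point where the line enters the positive definite cone. On the line the prior density is a
multiple of `τ^a exp(-c/τ - vτ)` with `a = n₀/2` and `v = uᵀWu`, while the second moment is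
`(2/n₀)(a/τ + c/τ²)`. Up to `2/n₀` this is the logarithmic derivative of `τ^a exp(-c/τ)`, so
integrating the derivative of the density over the line yields `(2/n₀) v` times the mass of the
line. The factor is the same on all lines, hence holds globally. Properness forces `v > 0`:
otherwise every line meeting the cone would carry infinite mass.

By conjugacy (`priorDensity_mul_dataDensity`, `lintegral_priorKernel_data`) the posterior has the
same form, with `∑ xₘ`, `½ ∑ xₘxₘᵀ` and `M` added to the parameters. The formula therefore applies
for almost every data set and gives, after polarization, the conditional expectations of all
products of two linear forms (`condExp_mul`), in particular of the entries of `CᵀC` and `Cᵀh`.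

The posterior risk is then a quadratic polynomial in `a` with positive definite leading part.
Completing the square (`postRisk_eq`) writes the regret of a rule as the finite regret of
`bayesRule` plus the integral of a positive definite form in the difference of the rules, whence
existence and almost sure uniqueness. -/

theorem lintegral_eq_lintegral_lines {E : Type*} [NormedAddCommGroup E] [NormedSpace ℝ E]
    [FiniteDimensional ℝ E] [MeasurableSpace E] [BorelSpace E] (μ : Measure E)
    [μ.IsAddHaarMeasure] (w : E) (ℓ : E → ℝ) (hℓ : Measurable ℓ)
    (hℓw : ∀ (θ : E) (s : ℝ), ℓ (θ + s • w) = ℓ θ + s) (F : E → ℝ≥0∞) (hF : Measurable F) :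
    ∫⁻ θ, F θ ∂μ = ∫⁻ θ in ℓ ⁻¹' Set.Ico 0 1, (∫⁻ s : ℝ, F (θ + s • w)) ∂μ := by
  have hS : MeasurableSet (ℓ ⁻¹' Set.Ico 0 1) := hℓ measurableSet_Ico
  have hadd : Measurable fun p : E × ℝ => p.1 + p.2 • w := by fun_prop
  have hmeas : Measurable fun p : E × ℝ =>
      (ℓ ⁻¹' Set.Ico (0 : ℝ) 1).indicator (fun _ => (1 : ℝ≥0∞)) p.1 * F (p.1 + p.2 • w) :=
    ((measurable_const.indicator hS).comp measurable_fst).mul (hF.comp hadd)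
  have hind : Measurable fun θ => (ℓ ⁻¹' Set.Ico (0 : ℝ) 1).indicator
      (fun _ => (1 : ℝ≥0∞)) θ := measurable_const.indicator hS
  symm
  -- Every line meets the slab `0 ≤ ℓ < 1` in a parameter interval of length one. Tonelli and
  -- translation invariance move the shift from `F` to the indicator of the slab, whose integral
  -- over `s` is that length. No complement of `w` has to be chosen.
  calc ∫⁻ θ in ℓ ⁻¹' Set.Ico 0 1, (∫⁻ s : ℝ, F (θ + s • w)) ∂μ
      = ∫⁻ θ, (∫⁻ s : ℝ, (ℓ ⁻¹' Set.Ico (0 : ℝ) 1).indicator (fun _ => (1 : ℝ≥0∞)) θ *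
          F (θ + s • w)) ∂μ := by
        rw [← lintegral_indicator hS]
        refine lintegral_congr fun θ => ?_
        by_cases h : θ ∈ ℓ ⁻¹' Set.Ico (0 : ℝ) 1
        · simp [Set.indicator_of_mem h]
        · simp [Set.indicator_of_notMem h]
    _ = ∫⁻ s : ℝ, ∫⁻ θ, (ℓ ⁻¹' Set.Ico (0 : ℝ) 1).indicator (fun _ => (1 : ℝ≥0∞)) θ *
          F (θ + s • w) ∂μ := lintegral_lintegral_swap hmeas.aemeasurable
    _ = ∫⁻ s : ℝ, ∫⁻ θ, (ℓ ⁻¹' Set.Ico (0 : ℝ) 1).indicator (fun _ => (1 : ℝ≥0∞))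
          (θ + (-s) • w) * F θ ∂μ := by
        refine lintegral_congr fun s => ?_
        rw [← lintegral_add_right_eq_self _ ((-s) • w)]
        refine lintegral_congr fun θ => ?_
        congr 2
        simp
    _ = ∫⁻ θ, (∫⁻ s : ℝ, (ℓ ⁻¹' Set.Ico (0 : ℝ) 1).indicator (fun _ => (1 : ℝ≥0∞))
          (θ + (-s) • w) * F θ) ∂μ := by
        refine (lintegral_lintegral_swap ?_).symm
        refine ((hind.comp ?_).mul (hF.comp measurable_fst)).aemeasurable
        fun_prop
    _ = ∫⁻ θ, F θ ∂μ := by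
        refine lintegral_congr fun θ => ?_
        have h1 : ∀ s : ℝ, (ℓ ⁻¹' Set.Ico (0 : ℝ) 1).indicator (fun _ => (1 : ℝ≥0∞))
            (θ + (-s) • w) = (Set.Ioc (ℓ θ - 1) (ℓ θ)).indicator (fun _ => (1 : ℝ≥0∞)) s := by
          intro s
          have : θ + (-s) • w ∈ ℓ ⁻¹' Set.Ico (0 : ℝ) 1 ↔ s ∈ Set.Ioc (ℓ θ - 1) (ℓ θ) := by
            rw [Set.mem_preimage, hℓw, Set.mem_Ico, Set.mem_Ioc]
            constructor <;> rintro ⟨h1, h2⟩ <;> constructor <;> linarith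
          by_cases h : s ∈ Set.Ioc (ℓ θ - 1) (ℓ θ)
          · rw [Set.indicator_of_mem h, Set.indicator_of_mem (this.2 h)]
          · rw [Set.indicator_of_notMem h, Set.indicator_of_notMem (fun h' => h (this.1 h'))]
        rw [lintegral_congr fun s => by rw [h1 s],
          lintegral_mul_const _ (measurable_const.indicator measurableSet_Ioc),
          lintegral_indicator measurableSet_Ioc]
        simp

/-- Up to a factor, the density of a Normal-Wishart distribution along a line of rank one. -/
noncomputable def rayDensity (a c v σ : ℝ) : ℝ := σ ^ a * Real.exp (-c / σ - v * σ)

theorem rayDensity_nonneg {a c v σ : ℝ} (hσ : 0 < σ) : 0 ≤ rayDensity a c v σ := by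
  unfold rayDensity; positivity

theorem rayDensity_le {a c v σ : ℝ} (hc : 0 ≤ c) (hσ : 0 < σ) :
    rayDensity a c v σ ≤ σ ^ a * Real.exp (-v * σ) := by
  unfold rayDensity
  have : 0 ≤ c / σ := by positivity
  gcongr
  rw [neg_div]; linarith

theorem measurable_rayDensity (a c v : ℝ) : Measurable (rayDensity a c v) := by
  unfold rayDensity; fun_prop

theorem integrableOn_rpow_mul_exp_neg_mul {s b : ℝ} (hs : -1 < s) (hb : 0 < b) :
    IntegrableOn (fun x : ℝ => x ^ s * Real.exp (-b * x)) (Set.Ioi 0) := by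
  simpa using integrableOn_rpow_mul_exp_neg_mul_rpow hs one_pos hb

theorem integrableOn_rayDensity {a c v : ℝ} (ha : 0 < a) (hc : 0 ≤ c) (hv : 0 < v) :
    IntegrableOn (rayDensity a c v) (Set.Ioi 0) := by
  refine Integrable.mono' (integrableOn_rpow_mul_exp_neg_mul (s := a) (by linarith) hv)
    (measurable_rayDensity a c v).aestronglyMeasurable ?_
  refine (ae_restrict_mem measurableSet_Ioi).mono fun σ hσ => ?_
  rw [Real.norm_of_nonneg (rayDensity_nonneg hσ)]
  exact rayDensity_le hc hσ

theorem integrableOn_rayDensity_moment {a c v : ℝ} (ha : 0 < a) (hc : 0 ≤ c) (hv : 0 < v) :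
    IntegrableOn (fun σ => (a / σ + c / σ ^ 2) * rayDensity a c v σ) (Set.Ioi 0) := by
  refine Integrable.mono' ((integrableOn_rpow_mul_exp_neg_mul (s := a - 1)
    (by linarith) hv).const_mul (a + 1)) ?_ ?_
  · have := measurable_rayDensity a c v
    exact Measurable.aestronglyMeasurable (by fun_prop)
  refine (ae_restrict_mem measurableSet_Ioi).mono fun σ hσ => ?_
  have hσ' : (0 : ℝ) < σ := hσ
  rw [Real.norm_of_nonneg (mul_nonneg (by positivity) (rayDensity_nonneg hσ))]
  -- The term `c / σ²` is too singular for `σ ^ a` alone; the factor `exp (-c / σ)` absorbs one `c /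
  -- σ`, which leaves an integrable multiple of `σ ^ (a - 1) * exp (-v σ)`.
  have h1 : c / σ * Real.exp (-c / σ) ≤ 1 := by
    rw [neg_div, Real.exp_neg, ← div_eq_mul_inv, div_le_one (Real.exp_pos _)]
    linarith [Real.add_one_le_exp (c / σ)]
  have h2 : Real.exp (-c / σ) ≤ 1 := by
    rw [Real.exp_le_one_iff, neg_div]
    have : 0 ≤ c / σ := by positivity
    linarith
  have h3 : (a / σ + c / σ ^ 2) * rayDensity a c v σ =
      (a * Real.exp (-c / σ) + c / σ * Real.exp (-c / σ)) *
        (σ ^ (a - 1) * Real.exp (-v * σ)) := by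
    unfold rayDensity
    rw [Real.rpow_sub_one hσ'.ne', sub_eq_add_neg, Real.exp_add, neg_mul]
    field_simp
  rw [h3]
  gcongr
  nlinarith

theorem hasDerivAt_rayDensity (a c v : ℝ) {σ : ℝ} (hσ : 0 < σ) :
    HasDerivAt (rayDensity a c v)
      ((a / σ + c / σ ^ 2) * rayDensity a c v σ - v * rayDensity a c v σ) σ := by
  unfold rayDensity
  have h1 := Real.hasDerivAt_rpow_const (x := σ) (p := a) (Or.inl hσ.ne')
  have h2 : HasDerivAt (fun σ : ℝ => -c / σ - v * σ) (c / σ ^ 2 - v) σ := by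
    have := ((hasDerivAt_inv hσ.ne').const_mul (-c)).sub ((hasDerivAt_id σ).const_mul v)
    refine this.congr_deriv ?_
    field_simp
  refine (h1.mul h2.exp).congr_deriv ?_
  rw [Real.rpow_sub_one hσ.ne']
  field_simp
  ring

/-- The difference of the two integrands is the derivative of `rayDensity`, which vanishes at `0`
because `a > 0` and at infinity because `v > 0`. -/
theorem integral_rayDensity_moment {a c v : ℝ} (ha : 0 < a) (hc : 0 ≤ c) (hv : 0 < v) :
    ∫ σ in Set.Ioi 0, (a / σ + c / σ ^ 2) * rayDensity a c v σ =
      v * ∫ σ in Set.Ioi 0, rayDensity a c v σ := by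
  have i1 := integrableOn_rayDensity_moment ha hc hv
  have i2 := (integrableOn_rayDensity ha hc hv).const_mul v
  -- The value of `-c / 0` does not matter, since `0 ^ a = 0`.
  have h0 : rayDensity a c v 0 = 0 := by simp [rayDensity, Real.zero_rpow ha.ne']
  have key := integral_Ioi_of_hasDerivAt_of_tendsto (f := rayDensity a c v) (a := 0) (m := 0)
    ?_ (fun σ hσ => hasDerivAt_rayDensity a c v hσ) (i1.sub i2) ?_
  · rw [integral_sub i1 i2, integral_const_mul, h0] at key
    linarith
  · rw [← continuousWithinAt_Ioi_iff_Ici, ContinuousWithinAt, h0]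
    have hlim : Filter.Tendsto (fun σ : ℝ => σ ^ a * Real.exp (-v * σ)) (nhdsWithin 0 (Set.Ioi 0))
        (nhds 0) := by
      have : Continuous fun σ : ℝ => σ ^ a * Real.exp (-v * σ) :=
        (Real.continuous_rpow_const ha.le).mul (by fun_prop)
      have h := (this.tendsto 0).mono_left (nhdsWithin_le_nhds (s := Set.Ioi 0))
      simpa [Real.zero_rpow ha.ne'] using h
    refine tendsto_of_tendsto_of_tendsto_of_le_of_le' tendsto_const_nhds hlim ?_ ?_
    · filter_upwards [self_mem_nhdsWithin] with σ hσ using rayDensity_nonneg hσ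
    · filter_upwards [self_mem_nhdsWithin] with σ hσ using rayDensity_le hc hσ
  · refine tendsto_of_tendsto_of_tendsto_of_le_of_le' tendsto_const_nhds
      (tendsto_rpow_mul_exp_neg_mul_atTop_nhds_zero a v hv) ?_ ?_
    · filter_upwards [Filter.Ioi_mem_atTop 0] with σ hσ using rayDensity_nonneg hσ
    · filter_upwards [Filter.Ioi_mem_atTop 0] with σ hσ using rayDensity_le hc hσ

theorem lintegral_rayDensity_moment {a c v : ℝ} (ha : 0 < a) (hc : 0 ≤ c) (hv : 0 < v) :
    ∫⁻ σ in Set.Ioi 0, ENNReal.ofReal ((a / σ + c / σ ^ 2) * rayDensity a c v σ) =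
      ENNReal.ofReal v * ∫⁻ σ in Set.Ioi 0, ENNReal.ofReal (rayDensity a c v σ) := by
  rw [← ofReal_integral_eq_lintegral_ofReal (integrableOn_rayDensity_moment ha hc hv),
    ← ofReal_integral_eq_lintegral_ofReal (integrableOn_rayDensity ha hc hv),
    integral_rayDensity_moment ha hc hv, ENNReal.ofReal_mul hv.le]
  · exact (ae_restrict_mem measurableSet_Ioi).mono fun σ hσ => rayDensity_nonneg hσ
  · refine (ae_restrict_mem measurableSet_Ioi).mono fun σ hσ => ?_
    have hσ' : (0 : ℝ) < σ := hσ
    exact mul_nonneg (by positivity) (rayDensity_nonneg hσ)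

/-- On `(1, ∞)` the integrand is at least `exp (-c)`. This is how finiteness of the prior excludes
`v ≤ 0`. -/
theorem lintegral_rayDensity_eq_top {a c v : ℝ} (ha : 0 < a) (hc : 0 ≤ c) (hv : v ≤ 0) :
    ∫⁻ σ in Set.Ioi 0, ENNReal.ofReal (rayDensity a c v σ) = ∞ := by
  rw [eq_top_iff]
  calc ∞ = ∫⁻ _ in Set.Ioi (1 : ℝ), ENNReal.ofReal (Real.exp (-c)) := by
        simp [ENNReal.mul_top, Real.exp_pos]
    _ ≤ ∫⁻ σ in Set.Ioi 1, ENNReal.ofReal (rayDensity a c v σ) := by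
        refine setLIntegral_mono' measurableSet_Ioi fun σ hσ => ENNReal.ofReal_le_ofReal ?_
        have hσ' : (1 : ℝ) < σ := hσ
        have h1 : 1 ≤ σ ^ a := Real.one_le_rpow hσ'.le ha.le
        have h2 : Real.exp (-c) ≤ Real.exp (-c / σ - v * σ) := by
          gcongr
          have : c / σ ≤ c := div_le_self hc hσ'.le
          rw [neg_div]
          nlinarith
        unfold rayDensity
        nlinarith [Real.exp_pos (-c / σ - v * σ)]
    _ ≤ _ := lintegral_mono_set (Set.Ioi_subset_Ioi zero_le_one)

end BayesCV

namespace BayesCV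

/-! ### Gaussian densities -/

/-- The indicator of a box is the product of the indicators of its sides, so on boxes Fubini
factorizes the integral. Integrability makes the factors finite measures and gives access to the
product formula for Bochner integrals. -/
theorem pi_withDensity_ofReal {κ : Type*} [Fintype κ] {α : κ → Type*}
    [∀ i, MeasurableSpace (α i)] (μ : ∀ i, Measure (α i)) [∀ i, SigmaFinite (μ i)]
    (p : ∀ i, α i → ℝ) (hp0 : ∀ i x, 0 ≤ p i x) (hp : ∀ i, Integrable (p i) (μ i)) :
    Measure.pi (fun i => (μ i).withDensity fun x => ENNReal.ofReal (p i x)) =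
      (Measure.pi μ).withDensity fun x => ENNReal.ofReal (∏ i, p i (x i)) := by
  have : ∀ i, IsFiniteMeasure ((μ i).withDensity fun x => ENNReal.ofReal (p i x)) := fun i =>
    isFiniteMeasure_withDensity_ofReal (hp i).2
  refine Measure.pi_eq fun s hs => ?_
  rw [withDensity_apply _ (MeasurableSet.univ_pi hs)]
  simp_rw [fun i => withDensity_apply (μ := μ i) (fun x => ENNReal.ofReal (p i x)) (hs i)]
  have h1 : ∀ x, (Set.univ.pi s).indicator (fun x => ∏ i, p i (x i)) x =
      ∏ i, (s i).indicator (p i) (x i) := by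
    intro x
    by_cases hx : x ∈ Set.univ.pi s
    · rw [Set.indicator_of_mem hx]
      exact Finset.prod_congr rfl fun i _ => (Set.indicator_of_mem (hx i trivial) _).symm
    · rw [Set.indicator_of_notMem hx]
      simp only [Set.mem_pi, Set.mem_univ, true_imp_iff, not_forall] at hx
      obtain ⟨i, hi⟩ := hx
      exact (Finset.prod_eq_zero (Finset.mem_univ i) (Set.indicator_of_notMem hi _)).symm
  have hint : Integrable (fun x : ∀ i, α i => ∏ i, p i (x i)) (Measure.pi μ) :=
    Integrable.fintype_prod_dep hp
  rw [← ofReal_integral_eq_lintegral_ofReal hint.restrict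
    (.of_forall fun x => Finset.prod_nonneg fun i _ => hp0 i _),
    ← integral_indicator (MeasurableSet.univ_pi hs)]
  simp_rw [h1]
  rw [integral_fintype_prod_eq_prod (fun i => (s i).indicator (p i)),
    ENNReal.ofReal_prod_of_nonneg fun i _ => integral_nonneg fun x =>
      Set.indicator_nonneg (fun x _ => hp0 i x) x]
  refine Finset.prod_congr rfl fun i _ => ?_
  rw [integral_indicator (hs i), ofReal_integral_eq_lintegral_ofReal (hp i).restrict
    (.of_forall fun x => hp0 i x)]

variable {ι : Type*} [Fintype ι]

theorem stdGaussian_eq_withDensity :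
    stdGaussian (EuclideanSpace ℝ ι) = volume.withDensity fun x =>
      ENNReal.ofReal ((√(2 * Real.pi))⁻¹ ^ Fintype.card ι *
        Real.exp (-(x.ofLp ⬝ᵥ x.ofLp) / 2)) := by
  have h1 : gaussianReal 0 1 = volume.withDensity fun x =>
      ENNReal.ofReal (gaussianPDFReal 0 1 x) := by
    rw [gaussianReal_of_var_ne_zero _ one_ne_zero]; rfl
  have h2 := pi_withDensity_ofReal (κ := ι) (fun _ => (volume : Measure ℝ))
    (fun _ => gaussianPDFReal 0 1) (fun _ => gaussianPDFReal_nonneg 0 1)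
    (fun _ => integrable_gaussianPDFReal 0 1)
  rw [← map_pi_eq_stdGaussian, h1, h2]
  have h3 : ∀ x : ι → ℝ, ∏ i, gaussianPDFReal 0 1 (x i) =
      (√(2 * Real.pi))⁻¹ ^ Fintype.card ι * Real.exp (-(x ⬝ᵥ x) / 2) := by
    intro x
    simp only [gaussianPDFReal, Finset.prod_mul_distrib, Finset.prod_const, ← Real.exp_sum]
    simp [dotProduct, Finset.card_univ, ← Finset.sum_div, pow_two]
  simp_rw [h3]
  ext s hs
  have hmp := (PiLp.volume_preserving_toLp ι)
  rw [Measure.map_apply hmp.measurable hs, withDensity_apply _ (hmp.measurable hs),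
    withDensity_apply _ hs, ← hmp.setLIntegral_comp_preimage hs]
  · rfl
  · fun_prop

theorem measurable_dotProduct_mulVec (Λ : Matrix ι ι ℝ) (m : ι → ℝ) :
    Measurable fun x : EuclideanSpace ℝ ι => (x.ofLp - m) ⬝ᵥ Λ *ᵥ (x.ofLp - m) := by
  unfold dotProduct mulVec dotProduct
  fun_prop

theorem map_toEuclideanCLM_volume [DecidableEq ι] {R : Matrix ι ι ℝ} (hR : R.det ≠ 0)
    (m : EuclideanSpace ℝ ι) :
    (volume : Measure (EuclideanSpace ℝ ι)).map
      (fun x => m + toEuclideanCLM (𝕜 := ℝ) R x) = ENNReal.ofReal |R.det⁻¹| • volume := by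
  have hdet : LinearMap.det (toEuclideanLin R) = R.det := by
    rw [toEuclideanLin_eq_toLin_orthonormal, LinearMap.det_toLin]
  have h1 : (fun x => m + toEuclideanCLM (𝕜 := ℝ) R x) =
      (fun x => m + x) ∘ (toEuclideanLin R) := rfl
  have hm : Measurable (toEuclideanLin R) :=
    (toEuclideanLin R).continuous_of_finiteDimensional.measurable
  rw [h1, ← Measure.map_map (measurable_const_add m) hm,
    Measure.map_linearMap_addHaar_eq_smul_addHaar _ (by rwa [hdet]), Measure.map_smul,
    map_add_left_eq_self, hdet]

-- Change of variables `x = m + R y` with `R` the square root of `Λ⁻¹`: the relation `R Λ R = 1`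
-- turns `yᵀy` into the quadratic form of `Λ`, and the Jacobian factor is `|det R|⁻¹ = √(det Λ)`.
open scoped MatrixOrder in
theorem multivariateGaussian_eq_withDensity [DecidableEq ι] {Λ : Matrix ι ι ℝ} (hΛ : Λ.PosDef)
    (m : ι → ℝ) :
    multivariateGaussian (WithLp.toLp 2 m) Λ⁻¹ = volume.withDensity fun x =>
      ENNReal.ofReal ((√(2 * Real.pi))⁻¹ ^ Fintype.card ι * √Λ.det *
        Real.exp (-((x.ofLp - m) ⬝ᵥ Λ *ᵥ (x.ofLp - m)) / 2)) := by
  set R := CFC.sqrt Λ⁻¹ with hR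
  have hRR : R * R = Λ⁻¹ := CFC.sqrt_mul_sqrt_self _ hΛ.inv.posSemidef.nonneg
  have hRt : Rᵀ = R := by
    have := (CFC.sqrt_nonneg Λ⁻¹).isSelfAdjoint
    simpa [IsSelfAdjoint, star_eq_conjTranspose, conjTranspose_eq_transpose_of_trivial] using this
  have hdetΛ : 0 < Λ.det := hΛ.det_pos
  have hdetR : R.det * R.det = Λ.det⁻¹ := by
    rw [← det_mul, hRR, det_nonsing_inv, Ring.inverse_eq_inv']
  have hdetR0 : R.det ≠ 0 := by
    intro h
    rw [h, zero_mul] at hdetR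
    exact (inv_pos.2 hdetΛ).ne hdetR
  have habs : |R.det⁻¹| = √Λ.det := by
    rw [← Real.sqrt_sq_eq_abs, inv_pow, pow_two, hdetR, inv_inv]
  have hRΛR : R * Λ * R = 1 := by
    have h1 : R * (R * Λ) = 1 := by
      rw [← Matrix.mul_assoc, hRR, nonsing_inv_mul _ hdetΛ.ne'.isUnit]
    exact mul_eq_one_comm.1 h1
  have hT : Measurable fun x : EuclideanSpace ℝ ι =>
      WithLp.toLp 2 m + toEuclideanCLM (𝕜 := ℝ) R x := by fun_prop
  have hg := measurable_dotProduct_mulVec Λ m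
  unfold multivariateGaussian
  rw [← hR, stdGaussian_eq_withDensity]
  ext s hs
  rw [Measure.map_apply hT hs, withDensity_apply _ (hT hs), withDensity_apply _ hs]
  have h2 : ∀ y : EuclideanSpace ℝ ι, y.ofLp ⬝ᵥ y.ofLp =
      ((WithLp.toLp 2 m + toEuclideanCLM (𝕜 := ℝ) R y).ofLp - m) ⬝ᵥ
        Λ *ᵥ ((WithLp.toLp 2 m + toEuclideanCLM (𝕜 := ℝ) R y).ofLp - m) := by
    intro y
    have h3 : (WithLp.toLp 2 m + toEuclideanCLM (𝕜 := ℝ) R y).ofLp - m = R *ᵥ y.ofLp := by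
      simp
    rw [h3, mulVec_mulVec, dotProduct_mulVec, vecMul_mulVec, hRt, ← dotProduct_mulVec,
      ← Matrix.mul_assoc, hRΛR, one_mulVec]
  simp_rw [h2]
  rw [← setLIntegral_map (f := fun x : EuclideanSpace ℝ ι => ENNReal.ofReal
      ((√(2 * Real.pi))⁻¹ ^ Fintype.card ι *
        Real.exp (-((x.ofLp - m) ⬝ᵥ Λ *ᵥ (x.ofLp - m)) / 2))) hs (by fun_prop) hT,
    map_toEuclideanCLM_volume hdetR0, Measure.restrict_smul, lintegral_smul_measure, habs,
    smul_eq_mul, ← lintegral_const_mul _ (by fun_prop)]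
  refine lintegral_congr fun x => ?_
  rw [← ENNReal.ofReal_mul (Real.sqrt_nonneg _)]
  congr 1
  ring

variable [DecidableEq ι]

theorem Param.isSymm_Lam {ι : Type*} (θ : Param ι) : θ.Lam.IsSymm := by
  ext i j
  simp [Param.Lam, Sym2.eq_swap]

theorem quadratic_eq_complete_square {θ : Param ι} (hΛ : θ.Lam.PosDef) (x : ι → ℝ) :
    θ.eta ⬝ᵥ x - (x ⬝ᵥ θ.Lam *ᵥ x) / 2 = (θ.eta ⬝ᵥ θ.Lam⁻¹ *ᵥ θ.eta) / 2 +
      -((x - θ.Lam⁻¹ *ᵥ θ.eta) ⬝ᵥ θ.Lam *ᵥ (x - θ.Lam⁻¹ *ᵥ θ.eta)) / 2 := by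
  have h1 : θ.Lam *ᵥ (θ.Lam⁻¹ *ᵥ θ.eta) = θ.eta := by
    rw [mulVec_mulVec, mul_nonsing_inv _ hΛ.det_pos.ne'.isUnit, one_mulVec]
  have h2 : (θ.Lam⁻¹ *ᵥ θ.eta) ⬝ᵥ θ.Lam *ᵥ x = x ⬝ᵥ θ.eta := by
    rw [dotProduct_mulVec, ← mulVec_transpose, θ.isSymm_Lam.eq, h1, dotProduct_comm]
  rw [mulVec_sub, h1, sub_dotProduct, dotProduct_sub, dotProduct_sub, h2,
    dotProduct_comm θ.eta x, dotProduct_comm θ.eta (θ.Lam⁻¹ *ᵥ θ.eta)]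
  ring

/-- No Gaussian integral is computed: after completing the square, the constant is read off from the
fact that `multivariateGaussian` has total mass one. -/
theorem integral_exp_quadratic {θ : Param ι} (hΛ : θ.Lam.PosDef) :
    (∫ x : ι → ℝ, Real.exp (θ.eta ⬝ᵥ x - (x ⬝ᵥ θ.Lam *ᵥ x) / 2)) =
      Real.exp ((θ.eta ⬝ᵥ θ.Lam⁻¹ *ᵥ θ.eta) / 2) *
        ((√(2 * Real.pi))⁻¹ ^ Fintype.card ι * √θ.Lam.det)⁻¹ := by
  have hc : 0 < (√(2 * Real.pi))⁻¹ ^ Fintype.card ι * √θ.Lam.det := by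
    have := hΛ.det_pos
    positivity
  simp_rw [quadratic_eq_complete_square hΛ, Real.exp_add]
  rw [integral_const_mul]
  congr 1
  refine eq_inv_of_mul_eq_one_left ?_
  rw [← integral_mul_const]
  have hmp := PiLp.volume_preserving_toLp ι
  have hm := measurable_dotProduct_mulVec θ.Lam (θ.Lam⁻¹ *ᵥ θ.eta)
  have h1 := congrArg (fun μ : Measure (EuclideanSpace ℝ ι) => μ Set.univ)
    (multivariateGaussian_eq_withDensity hΛ (θ.Lam⁻¹ *ᵥ θ.eta))
  simp only [measure_univ, withDensity_apply _ MeasurableSet.univ, Measure.restrict_univ] at h1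
  rw [← hmp.lintegral_comp (by fun_prop)] at h1
  rw [integral_eq_lintegral_of_nonneg_ae (.of_forall fun x => by positivity), ← ENNReal.toReal_one,
    h1]
  · simp_rw [mul_comm (Real.exp _)]
  · exact (Measurable.comp (g := fun x : EuclideanSpace ℝ ι => Real.exp
      (-((x.ofLp - θ.Lam⁻¹ *ᵥ θ.eta) ⬝ᵥ θ.Lam *ᵥ (x.ofLp - θ.Lam⁻¹ *ᵥ θ.eta)) / 2) * _)
      (by fun_prop) hmp.measurable).aestronglyMeasurable

theorem logPartition_eq {θ : Param ι} (hΛ : θ.Lam.PosDef) :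
    logPartition θ = (θ.eta ⬝ᵥ θ.Lam⁻¹ *ᵥ θ.eta) / 2 - Real.log θ.Lam.det / 2 +
      Fintype.card ι * Real.log (√(2 * Real.pi)) := by
  have := hΛ.det_pos
  rw [logPartition, integral_exp_quadratic hΛ, Real.log_mul (by positivity) (by positivity),
    Real.log_exp, Real.log_inv, Real.log_mul (by positivity) (by positivity), Real.log_pow,
    Real.log_inv, Real.log_sqrt this.le]
  ring

theorem likelihood_eq_withDensity {θ : Param ι} (hΛ : θ.Lam.PosDef) :
    likelihood θ = volume.withDensity fun x => ENNReal.ofReal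
      (Real.exp (θ.eta ⬝ᵥ x.ofLp - (x.ofLp ⬝ᵥ θ.Lam *ᵥ x.ofLp) / 2 - logPartition θ)) := by
  have hpos := hΛ.det_pos
  rw [likelihood, multivariateGaussian_eq_withDensity hΛ]
  congr 1 with x
  rw [Real.exp_sub _ (logPartition θ), quadratic_eq_complete_square hΛ, Real.exp_add]
  unfold logPartition
  rw [Real.exp_log, integral_exp_quadratic hΛ]
  · congr 1
    field_simp
  · rw [integral_exp_quadratic hΛ]
    positivity

/-- Variance plus squared mean of the linear form `uᵀx`. -/
theorem lintegral_sq_likelihood {θ : Param ι} (hΛ : θ.Lam.PosDef) (u : ι → ℝ) :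
    ∫⁻ x, ENNReal.ofReal ((u ⬝ᵥ x.ofLp) ^ 2) ∂(likelihood θ) =
      ENNReal.ofReal (u ⬝ᵥ θ.Lam⁻¹ *ᵥ u + (u ⬝ᵥ θ.Lam⁻¹ *ᵥ θ.eta) ^ 2) := by
  unfold likelihood
  set ν := multivariateGaussian (WithLp.toLp 2 (θ.Lam⁻¹ *ᵥ θ.eta)) θ.Lam⁻¹ with hν
  set v : EuclideanSpace ℝ ι := WithLp.toLp 2 u
  have hv : ∀ x : EuclideanSpace ℝ ι, u ⬝ᵥ x.ofLp = inner ℝ v x := by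
    intro x
    simp [PiLp.inner_apply, v, dotProduct, mul_comm]
  have hL2 : MemLp (fun x : EuclideanSpace ℝ ι => inner ℝ v x) 2 ν :=
    (IsGaussian.memLp_two_id (μ := ν)).const_inner v
  have hcov := covarianceBilin_multivariateGaussian (μ := WithLp.toLp 2 (θ.Lam⁻¹ *ᵥ θ.eta))
    hΛ.inv.posSemidef v v
  rw [covarianceBilin_apply_eq_cov IsGaussian.memLp_two_id, covariance_self (by fun_prop),
    variance_eq_sub hL2] at hcov
  have hmean : ∫ x, inner ℝ v x ∂ν = u ⬝ᵥ θ.Lam⁻¹ *ᵥ θ.eta := by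
    rw [hv (WithLp.toLp 2 (θ.Lam⁻¹ *ᵥ θ.eta)),
      ← integral_id_multivariateGaussian (μ := WithLp.toLp 2 (θ.Lam⁻¹ *ᵥ θ.eta)) (S := θ.Lam⁻¹)]
    exact integral_inner (μ := ν) IsGaussian.integrable_id v
  rw [lintegral_congr fun x => by rw [hv x]]
  rw [← ofReal_integral_eq_lintegral_ofReal hL2.integrable_sq (.of_forall fun x => sq_nonneg _)]
  congr 1
  rw [hmean] at hcov
  simp only [Pi.pow_apply] at hcov
  linarith

end BayesCV

namespace BayesCV

variable {ι : Type*}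

/-! ### Rank-one perturbations -/

/-- The direction `(0, u uᵀ)` in the parameter space. -/
def Param.rankOne (u : ι → ℝ) : Param ι :=
  (0, Sym2.lift ⟨fun i j => u i * u j, fun _ _ => mul_comm _ _⟩)

theorem Param.eta_add_rankOne (θ : Param ι) (s : ℝ) (u : ι → ℝ) :
    (θ + s • Param.rankOne u).eta = θ.eta := by
  simp [Param.eta, Param.rankOne]

theorem Param.Lam_add_rankOne (θ : Param ι) (s : ℝ) (u : ι → ℝ) :
    (θ + s • Param.rankOne u).Lam = θ.Lam + s • vecMulVec u u := by
  ext i j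
  simp [Param.Lam, Param.rankOne, vecMulVec_apply]

theorem _root_.Matrix.PosDef.isSymm {Λ : Matrix ι ι ℝ} (h : Λ.PosDef) : Λ.IsSymm := by
  simpa [IsSymm, IsHermitian, conjTranspose_eq_transpose_of_trivial] using h.isHermitian

variable [Fintype ι]

theorem add_smul_vecMulVec_mulVec (Λ : Matrix ι ι ℝ) (s : ℝ) (u x : ι → ℝ) :
    (Λ + s • vecMulVec u u) *ᵥ x = Λ *ᵥ x + (s * (u ⬝ᵥ x)) • u := by
  rw [add_mulVec, smul_mulVec, vecMulVec_mulVec]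
  ext i
  simp [mul_comm, mul_left_comm]

theorem posDef_of_dotProduct_pos {Λ : Matrix ι ι ℝ} (hs : Λ.IsSymm)
    (h : ∀ x : ι → ℝ, x ≠ 0 → 0 < x ⬝ᵥ Λ *ᵥ x) : Λ.PosDef :=
  PosDef.of_dotProduct_mulVec_pos
    (by rwa [IsHermitian, conjTranspose_eq_transpose_of_trivial]) fun {x} hx => by simpa using h x hx

theorem _root_.Matrix.PosDef.dotProduct_pos {Λ : Matrix ι ι ℝ} (h : Λ.PosDef) {x : ι → ℝ}
    (hx : x ≠ 0) : 0 < x ⬝ᵥ Λ *ᵥ x := by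
  simpa using h.dotProduct_mulVec_pos hx

theorem trace_transpose_mul_add_smul_vecMulVec (W Λ : Matrix ι ι ℝ) (s : ℝ) (u : ι → ℝ) :
    (Wᵀ * (Λ + s • vecMulVec u u)).trace = (Wᵀ * Λ).trace + s * (u ⬝ᵥ W *ᵥ u) := by
  rw [Matrix.mul_add, trace_add, Matrix.mul_smul, trace_smul, mul_vecMulVec, trace_vecMulVec,
    mulVec_transpose, dotProduct_mulVec, smul_eq_mul]

variable [DecidableEq ι]

theorem _root_.Matrix.PosDef.mulVec_inv {Λ : Matrix ι ι ℝ} (h : Λ.PosDef) (z : ι → ℝ) :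
    Λ *ᵥ (Λ⁻¹ *ᵥ z) = z := by
  rw [mulVec_mulVec, mul_nonsing_inv _ h.det_pos.ne'.isUnit, one_mulVec]

theorem dotProduct_inv_mulVec_comm {Λ : Matrix ι ι ℝ} (h : Λ.PosDef) (y z : ι → ℝ) :
    y ⬝ᵥ Λ⁻¹ *ᵥ z = z ⬝ᵥ Λ⁻¹ *ᵥ y := by
  rw [dotProduct_mulVec, ← mulVec_transpose, h.inv.isSymm.eq, dotProduct_comm]

/-- Cauchy–Schwarz for the form `Λ` and its dual: evaluate `Λ` at the residual of `x` after
projection onto `Λ⁻¹ u`. -/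
theorem sq_dotProduct_le {Λ : Matrix ι ι ℝ} (h : Λ.PosDef) (u x : ι → ℝ) :
    (u ⬝ᵥ x) ^ 2 ≤ (u ⬝ᵥ Λ⁻¹ *ᵥ u) * (x ⬝ᵥ Λ *ᵥ x) := by
  by_cases hu : u = 0
  · simp [hu]
  have hq := h.inv.dotProduct_pos hu
  set q := u ⬝ᵥ Λ⁻¹ *ᵥ u with hq'
  have h1 : 0 ≤ (x - ((u ⬝ᵥ x) / q) • (Λ⁻¹ *ᵥ u)) ⬝ᵥ Λ *ᵥ (x - ((u ⬝ᵥ x) / q) • (Λ⁻¹ *ᵥ u)) := by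
    simpa using h.posSemidef.dotProduct_mulVec_nonneg (x - ((u ⬝ᵥ x) / q) • (Λ⁻¹ *ᵥ u))
  have h2 : (Λ⁻¹ *ᵥ u) ⬝ᵥ Λ *ᵥ x = u ⬝ᵥ x := by
    rw [dotProduct_mulVec, ← mulVec_transpose, h.isSymm.eq, h.mulVec_inv]
  rw [mulVec_sub, mulVec_smul, h.mulVec_inv, sub_dotProduct, dotProduct_sub, dotProduct_sub,
    smul_dotProduct, smul_dotProduct, h2, dotProduct_smul, dotProduct_smul,
    dotProduct_comm (Λ⁻¹ *ᵥ u) u, ← hq', dotProduct_comm x u] at h1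
  simp only [smul_eq_mul] at h1
  have h3 : u ⬝ᵥ x / q * q = u ⬝ᵥ x := by field_simp
  have h4 : 0 ≤ x ⬝ᵥ Λ *ᵥ x - (u ⬝ᵥ x) ^ 2 / q := by
    rw [h3] at h1
    have : u ⬝ᵥ x / q * (u ⬝ᵥ x) = (u ⬝ᵥ x) ^ 2 / q := by ring
    linarith
  rw [sub_nonneg, div_le_iff₀ hq] at h4
  linarith

/-- The line meets the cone exactly in the half-line `s > -1/q` with `q = uᵀΛ⁻¹u`. Necessity comes
from the test vector `Λ⁻¹ u`; sufficiency for `s < 0` is `sq_dotProduct_le`. -/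
theorem posDef_add_smul_vecMulVec_iff {Λ : Matrix ι ι ℝ} (h : Λ.PosDef) {u : ι → ℝ} (hu : u ≠ 0)
    (s : ℝ) : (Λ + s • vecMulVec u u).PosDef ↔ 0 < 1 + s * (u ⬝ᵥ Λ⁻¹ *ᵥ u) := by
  have hq := h.inv.dotProduct_pos hu
  constructor
  · intro hs
    have hx : Λ⁻¹ *ᵥ u ≠ 0 := by
      intro h0
      simp [h0] at hq
    have := hs.dotProduct_pos hx
    rw [add_smul_vecMulVec_mulVec, h.mulVec_inv, dotProduct_add, dotProduct_smul,
      dotProduct_comm (Λ⁻¹ *ᵥ u) u, smul_eq_mul] at this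
    by_contra! hcon
    nlinarith
  · intro hs
    refine posDef_of_dotProduct_pos ?_ fun x hx => ?_
    · rw [IsSymm, transpose_add, transpose_smul, h.isSymm.eq, transpose_vecMulVec]
    · have hx' := h.dotProduct_pos hx
      rw [add_smul_vecMulVec_mulVec, dotProduct_add, dotProduct_smul, dotProduct_comm x u,
        smul_eq_mul]
      have hcs := sq_dotProduct_le h u x
      rcases le_or_gt 0 s with hs0 | hs0
      · nlinarith [mul_nonneg hs0 (sq_nonneg (u ⬝ᵥ x))]
      · nlinarith [mul_pos hs hx']

/-- The matrix determinant lemma. -/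
theorem det_add_smul_vecMulVec {Λ : Matrix ι ι ℝ} (h : Λ.PosDef) (u : ι → ℝ) (s : ℝ) :
    (Λ + s • vecMulVec u u).det = Λ.det * (1 + s * (u ⬝ᵥ Λ⁻¹ *ᵥ u)) := by
  have h1 : s • vecMulVec u u = replicateCol Unit (s • u) * replicateRow Unit u := by
    rw [vecMulVec_eq Unit, replicateCol_smul, Matrix.smul_mul]
  rw [h1, det_add_replicateCol_mul_replicateRow h.det_pos.ne'.isUnit]
  congr 1
  rw [det_unique, Matrix.add_apply, one_apply_eq, Matrix.mul_assoc, ← replicateCol_mulVec,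
    replicateRow_mul_replicateCol_apply, mulVec_smul, dotProduct_smul, smul_eq_mul]

/-- The Sherman–Morrison formula, verified by applying the perturbed matrix to the right-hand side.
-/
theorem inv_add_smul_vecMulVec_mulVec {Λ : Matrix ι ι ℝ} (h : Λ.PosDef) {u : ι → ℝ}
    (hu : u ≠ 0) {s : ℝ} (hs : 0 < 1 + s * (u ⬝ᵥ Λ⁻¹ *ᵥ u)) (z : ι → ℝ) :
    (Λ + s • vecMulVec u u)⁻¹ *ᵥ z =
      Λ⁻¹ *ᵥ z - (s * (u ⬝ᵥ Λ⁻¹ *ᵥ z) / (1 + s * (u ⬝ᵥ Λ⁻¹ *ᵥ u))) • (Λ⁻¹ *ᵥ u) := by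
  have hs' := (posDef_add_smul_vecMulVec_iff h hu s).2 hs
  have h1 : (Λ + s • vecMulVec u u) *ᵥ (Λ⁻¹ *ᵥ z -
      (s * (u ⬝ᵥ Λ⁻¹ *ᵥ z) / (1 + s * (u ⬝ᵥ Λ⁻¹ *ᵥ u))) • (Λ⁻¹ *ᵥ u)) = z := by
    rw [add_smul_vecMulVec_mulVec, mulVec_sub, mulVec_smul, h.mulVec_inv, h.mulVec_inv,
      dotProduct_sub, dotProduct_smul, smul_eq_mul]
    ext i
    simp only [Pi.add_apply, Pi.sub_apply, Pi.smul_apply, smul_eq_mul]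
    field_simp
    ring
  conv_lhs => rw [← h1]
  rw [mulVec_mulVec, nonsing_inv_mul _ hs'.det_pos.ne'.isUnit, one_mulVec]

theorem dotProduct_inv_add_smul_vecMulVec {Λ : Matrix ι ι ℝ} (h : Λ.PosDef) {u : ι → ℝ}
    (hu : u ≠ 0) {s : ℝ} (hs : 0 < 1 + s * (u ⬝ᵥ Λ⁻¹ *ᵥ u)) (z : ι → ℝ) :
    u ⬝ᵥ (Λ + s • vecMulVec u u)⁻¹ *ᵥ z = (u ⬝ᵥ Λ⁻¹ *ᵥ z) / (1 + s * (u ⬝ᵥ Λ⁻¹ *ᵥ u)) := by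
  rw [inv_add_smul_vecMulVec_mulVec h hu hs, dotProduct_sub, dotProduct_smul, smul_eq_mul]
  field_simp
  ring

/-! ### The prior density -/

/-- The density of the unnormalized prior. -/
noncomputable def priorDensity (t₀ : ι → ℝ) (W : Matrix ι ι ℝ) (n₀ : ℝ) (θ : Param ι) : ℝ :=
  Real.exp (t₀ ⬝ᵥ θ.eta - (Wᵀ * θ.Lam).trace - n₀ * logPartition θ)

/-- The second moment of `uᵀ x` under the likelihood with parameter `θ`. -/
noncomputable def secondMoment (u : ι → ℝ) (θ : Param ι) : ℝ :=
  u ⬝ᵥ θ.Lam⁻¹ *ᵥ u + (u ⬝ᵥ θ.Lam⁻¹ *ᵥ θ.eta) ^ 2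

/-- With `q = uᵀΛ⁻¹u` and `s = τ - 1/q` one has `1 + s q = τ q`, so along the line the variance of
`uᵀx` is `1/τ` and its mean is proportional to `1/τ`. The constants are arranged to match the
derivative of `rayDensity`. -/
theorem secondMoment_line {θ : Param ι} (h : θ.Lam.PosDef) {u : ι → ℝ} (hu : u ≠ 0) {n₀ : ℝ}
    (hn : 0 < n₀) {τ : ℝ} (hτ : 0 < τ) :
    secondMoment u (θ + (τ - (u ⬝ᵥ θ.Lam⁻¹ *ᵥ u)⁻¹) • Param.rankOne u) =
      2 / n₀ * (n₀ / 2 / τ +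
        n₀ / 2 * ((u ⬝ᵥ θ.Lam⁻¹ *ᵥ θ.eta) / (u ⬝ᵥ θ.Lam⁻¹ *ᵥ u)) ^ 2 / τ ^ 2) := by
  have hq := h.inv.dotProduct_pos hu
  have hs : 1 + (τ - (u ⬝ᵥ θ.Lam⁻¹ *ᵥ u)⁻¹) * (u ⬝ᵥ θ.Lam⁻¹ *ᵥ u) =
      τ * (u ⬝ᵥ θ.Lam⁻¹ *ᵥ u) := by
    field_simp
    ring
  have hs' := hs ▸ mul_pos hτ hq
  rw [secondMoment, Param.eta_add_rankOne, Param.Lam_add_rankOne,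
    dotProduct_inv_add_smul_vecMulVec h hu hs', dotProduct_inv_add_smul_vecMulVec h hu hs', hs]
  field_simp

/-- Three terms of the exponent depend on `τ`: the log-determinant in `-n₀ A` gives `τ ^ (n₀/2)`,
Sherman–Morrison applied to `ηᵀΛ⁻¹η` gives `-c/τ`, and the trace gives `-τ uᵀWu`. All the rest goes
into `C`. -/
theorem priorDensity_line (t₀ : ι → ℝ) (W : Matrix ι ι ℝ) (n₀ : ℝ)
    {θ : Param ι} (h : θ.Lam.PosDef) {u : ι → ℝ} (hu : u ≠ 0) :
    ∃ C : ℝ, 0 < C ∧ ∀ τ : ℝ, 0 < τ →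
      priorDensity t₀ W n₀ (θ + (τ - (u ⬝ᵥ θ.Lam⁻¹ *ᵥ u)⁻¹) • Param.rankOne u) =
        C * rayDensity (n₀ / 2)
          (n₀ / 2 * ((u ⬝ᵥ θ.Lam⁻¹ *ᵥ θ.eta) / (u ⬝ᵥ θ.Lam⁻¹ *ᵥ u)) ^ 2)
          (u ⬝ᵥ W *ᵥ u) τ := by
  have hq := h.inv.dotProduct_pos hu
  set q := u ⬝ᵥ θ.Lam⁻¹ *ᵥ u with hqdef
  set b := u ⬝ᵥ θ.Lam⁻¹ *ᵥ θ.eta with hb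
  refine ⟨Real.exp (t₀ ⬝ᵥ θ.eta - (Wᵀ * θ.Lam).trace + q⁻¹ * (u ⬝ᵥ W *ᵥ u) -
    n₀ * ((θ.eta ⬝ᵥ θ.Lam⁻¹ *ᵥ θ.eta) / 2 - b ^ 2 / (2 * q) - Real.log (θ.Lam.det * q) / 2 +
      Fintype.card ι * Real.log (√(2 * Real.pi)))), Real.exp_pos _, fun τ hτ => ?_⟩
  have hs : 1 + (τ - q⁻¹) * q = τ * q := by
    field_simp
    ring
  have hs' := hs ▸ mul_pos hτ hq
  have hdet := h.det_pos
  have hP : (θ + (τ - q⁻¹) • Param.rankOne u).Lam.PosDef := by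
    rw [Param.Lam_add_rankOne]
    exact (posDef_add_smul_vecMulVec_iff h hu _).2 hs'
  rw [priorDensity, logPartition_eq hP, Param.eta_add_rankOne, Param.Lam_add_rankOne,
    det_add_smul_vecMulVec h, trace_transpose_mul_add_smul_vecMulVec,
    inv_add_smul_vecMulVec_mulVec h hu hs', dotProduct_sub, dotProduct_smul, smul_eq_mul,
    ← hqdef, ← hb, hs, dotProduct_inv_mulVec_comm h θ.eta u, ← hb, rayDensity,
    Real.rpow_def_of_pos hτ, ← Real.exp_add, ← Real.exp_add,
    show θ.Lam.det * (τ * q) = (θ.Lam.det * q) * τ by ring,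
    Real.log_mul (mul_pos hdet hq).ne' hτ.ne']
  congr 1
  field_simp
  ring

end BayesCV

namespace BayesCV

/-! ### The second moment under the prior -/

variable {ι : Type*}

/-- The parameters with a positive definite matrix. -/
def posDefCone (ι : Type*) : Set (Param ι) := {θ | θ.Lam.PosDef}

theorem mem_posDefCone {θ : Param ι} : θ ∈ posDefCone ι ↔ θ.Lam.PosDef := Iff.rfl

theorem continuous_Lam : Continuous (Param.Lam : Param ι → Matrix ι ι ℝ) := by
  unfold Param.Lam
  exact continuous_matrix fun i j => by simp only [of_apply]; fun_prop

theorem measurable_eta : Measurable (Param.eta : Param ι → ι → ℝ) := measurable_fst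

theorem posDefCone_nonempty [DecidableEq ι] : (posDefCone ι).Nonempty := by
  have h1 : ∀ i j : ι, (1 : Matrix ι ι ℝ) i j = (1 : Matrix ι ι ℝ) j i := fun i j => by
    simp [one_apply, eq_comm]
  refine ⟨(0, Sym2.lift ⟨fun i j => (1 : Matrix ι ι ℝ) i j, h1⟩), ?_⟩
  have : Param.Lam ((0, Sym2.lift ⟨fun i j => (1 : Matrix ι ι ℝ) i j, h1⟩) : Param ι) = 1 := by
    ext i j
    simp [Param.Lam]
  rw [mem_posDefCone, this]
  exact PosDef.one

theorem lintegral_line_add (θ w : Param ι) (s₀ : ℝ) (F : Param ι → ℝ≥0∞) :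
    ∫⁻ s : ℝ, F (θ + s₀ • w + s • w) = ∫⁻ s : ℝ, F (θ + s • w) := by
  rw [← lintegral_add_left_eq_self (fun s : ℝ => F (θ + s • w)) s₀]
  refine lintegral_congr fun s => ?_
  rw [add_smul, add_assoc]

/-- If `u i ≠ 0`, the diagonal entry `Λ i i` grows along the line at rate `(u i)²`. -/
theorem exists_slice_coordinate {u : ι → ℝ} (hu : u ≠ 0) :
    ∃ ℓ : Param ι → ℝ, Measurable ℓ ∧
      ∀ (θ : Param ι) (s : ℝ), ℓ (θ + s • Param.rankOne u) = ℓ θ + s := by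
  obtain ⟨i, hi⟩ := Function.ne_iff.1 hu
  have hi' : u i ≠ 0 := hi
  refine ⟨fun θ => θ.2 s(i, i) / (u i * u i), ?_, fun θ s => ?_⟩
  · exact ((measurable_pi_apply _).comp measurable_snd).div_const _
  · simp [Param.rankOne]
    field_simp

theorem lintegral_eq_lintegral_Ioi (f g : ℝ → ℝ≥0∞) (r : ℝ) (h0 : ∀ τ ≤ 0, f (τ - r) = 0)
    (h1 : ∀ τ, 0 < τ → f (τ - r) = g τ) : ∫⁻ s, f s = ∫⁻ τ in Set.Ioi 0, g τ := by
  rw [← lintegral_sub_right_eq_self f r, ← lintegral_indicator measurableSet_Ioi]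
  refine lintegral_congr fun τ => ?_
  rcases le_or_gt τ 0 with h | h
  · rw [h0 τ h, Set.indicator_of_notMem (by simpa using h)]
  · rw [h1 τ h, Set.indicator_of_mem (by simpa using h)]

variable [Fintype ι]

theorem measurable_dotProduct_mulVec_of_apply {X : Type*} [MeasurableSpace X]
    {u v : X → ι → ℝ} {A : X → Matrix ι ι ℝ} (hu : Measurable u)
    (hA : ∀ i j, Measurable fun x => A x i j) (hv : Measurable v) :
    Measurable fun x => u x ⬝ᵥ A x *ᵥ v x :=
  Finset.measurable_sum _ fun i _ => ((measurable_pi_apply i).comp hu).mul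
    (Finset.measurable_sum _ fun j _ => (hA i j).mul ((measurable_pi_apply j).comp hv))

/-- By homogeneity, positivity need only be tested on the unit sphere, and on a compact set strict
positivity persists under small perturbations. -/
theorem isOpen_posDefCone : IsOpen (posDefCone ι) := by
  have h : posDefCone ι =
      {θ : Param ι | ∀ x ∈ Metric.sphere (0 : ι → ℝ) 1, 0 < x ⬝ᵥ θ.Lam *ᵥ x} := by
    ext θ
    refine ⟨fun h x hx => (mem_posDefCone.1 h).dotProduct_pos fun h0 => ?_,
      fun h => posDef_of_dotProduct_pos θ.isSymm_Lam fun x hx => ?_⟩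
    · simp [h0] at hx
    · have hx' : 0 < ‖x‖ := norm_pos_iff.2 hx
      have h1 := h (‖x‖⁻¹ • x) (by simp [norm_smul, hx'.ne'])
      rw [mulVec_smul, dotProduct_smul, smul_dotProduct, smul_eq_mul, smul_eq_mul] at h1
      have h3 := pos_of_mul_pos_right h1 (by positivity)
      exact pos_of_mul_pos_right h3 (by positivity)
  rw [h, isOpen_iff_mem_nhds]
  intro θ hθ
  refine (isCompact_sphere (0 : ι → ℝ) 1).eventually_forall_of_forall_eventually
    (P := fun (θ : Param ι) x => 0 < x ⬝ᵥ θ.Lam *ᵥ x) fun x hx => ?_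
  have hc : Continuous fun p : Param ι × (ι → ℝ) => p.2 ⬝ᵥ p.1.Lam *ᵥ p.2 :=
    continuous_snd.dotProduct ((continuous_Lam.comp continuous_fst).matrix_mulVec continuous_snd)
  exact hc.continuousAt.eventually (lt_mem_nhds (hθ x hx))

theorem measurableSet_posDefCone : MeasurableSet (posDefCone ι) :=
  isOpen_posDefCone.measurableSet

theorem measurable_logPartition : Measurable (logPartition : Param ι → ℝ) := by
  refine Real.measurable_log.comp (StronglyMeasurable.measurable ?_)
  refine StronglyMeasurable.integral_prod_right
    (f := fun (θ : Param ι) (x : ι → ℝ) => Real.exp (θ.eta ⬝ᵥ x - (x ⬝ᵥ θ.Lam *ᵥ x) / 2)) ?_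
  refine Continuous.stronglyMeasurable ?_
  have h1 : Continuous fun p : Param ι × (ι → ℝ) => p.2 ⬝ᵥ p.1.Lam *ᵥ p.2 :=
    continuous_snd.dotProduct ((continuous_Lam.comp continuous_fst).matrix_mulVec continuous_snd)
  have h2 : Continuous fun p : Param ι × (ι → ℝ) => p.1.eta ⬝ᵥ p.2 :=
    (continuous_fst.comp continuous_fst).dotProduct continuous_snd
  exact Real.continuous_exp.comp (h2.sub (h1.div_const 2))

theorem measurable_priorDensity (t₀ : ι → ℝ) (W : Matrix ι ι ℝ) (n₀ : ℝ) :
    Measurable (priorDensity t₀ W n₀) := by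
  have h1 : Continuous fun θ : Param ι => t₀ ⬝ᵥ θ.eta - (Wᵀ * θ.Lam).trace :=
    (continuous_const.dotProduct continuous_fst).sub
      (continuous_const.matrix_mul continuous_Lam).matrix_trace
  exact Real.measurable_exp.comp (h1.measurable.sub (measurable_logPartition.const_mul n₀))

/-- `F` times the density of the unnormalized prior, extended by zero to all parameters. -/
noncomputable def weighted (t₀ : ι → ℝ) (W : Matrix ι ι ℝ) (n₀ : ℝ) (F : Param ι → ℝ≥0∞) :
    Param ι → ℝ≥0∞ :=
  (posDefCone ι).indicator fun θ => F θ * ENNReal.ofReal (priorDensity t₀ W n₀ θ)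

theorem weighted_of_posDef (t₀ : ι → ℝ) (W : Matrix ι ι ℝ) (n₀ : ℝ) (F : Param ι → ℝ≥0∞)
    {θ : Param ι} (h : θ.Lam.PosDef) :
    weighted t₀ W n₀ F θ = F θ * ENNReal.ofReal (priorDensity t₀ W n₀ θ) :=
  Set.indicator_of_mem (mem_posDefCone.2 h) _

theorem weighted_of_not_posDef (t₀ : ι → ℝ) (W : Matrix ι ι ℝ) (n₀ : ℝ) (F : Param ι → ℝ≥0∞)
    {θ : Param ι} (h : ¬ θ.Lam.PosDef) : weighted t₀ W n₀ F θ = 0 :=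
  Set.indicator_of_notMem (fun h' => h (mem_posDefCone.1 h')) _

theorem measurable_weighted (t₀ : ι → ℝ) (W : Matrix ι ι ℝ) (n₀ : ℝ) {F : Param ι → ℝ≥0∞}
    (hF : Measurable F) : Measurable (weighted t₀ W n₀ F) :=
  (hF.mul (measurable_priorDensity t₀ W n₀).ennreal_ofReal).indicator measurableSet_posDefCone

theorem measurable_lintegral_line_weighted (t₀ : ι → ℝ) (W : Matrix ι ι ℝ) (n₀ : ℝ)
    {F : Param ι → ℝ≥0∞} (hF : Measurable F) (w : Param ι) :
    Measurable fun θ => ∫⁻ s : ℝ, weighted t₀ W n₀ F (θ + s • w) :=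
  Measurable.lintegral_prod_right'
    (f := fun p : Param ι × ℝ => weighted t₀ W n₀ F (p.1 + p.2 • w))
    ((measurable_weighted t₀ W n₀ hF).comp (by fun_prop))

theorem priorKernel_eq (t₀ : ι → ℝ) (W : Matrix ι ι ℝ) (n₀ : ℝ) :
    priorKernel t₀ W n₀ = (volume.restrict (posDefCone ι)).withDensity fun θ =>
      ENNReal.ofReal (priorDensity t₀ W n₀ θ) := rfl

theorem ae_priorKernel_posDef (t₀ : ι → ℝ) (W : Matrix ι ι ℝ) (n₀ : ℝ) :
    ∀ᵐ θ ∂(priorKernel t₀ W n₀), θ.Lam.PosDef :=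
  (withDensity_absolutelyContinuous _ _).ae_le (ae_restrict_mem measurableSet_posDefCone)

theorem lintegral_priorKernel (t₀ : ι → ℝ) (W : Matrix ι ι ℝ) (n₀ : ℝ) {F : Param ι → ℝ≥0∞}
    (hF : Measurable F) :
    ∫⁻ θ, F θ ∂(priorKernel t₀ W n₀) = ∫⁻ θ, weighted t₀ W n₀ F θ := by
  have h := (measurable_priorDensity t₀ W n₀).ennreal_ofReal
  rw [priorKernel_eq, lintegral_withDensity_eq_lintegral_mul _ h hF]
  unfold weighted
  rw [lintegral_indicator measurableSet_posDefCone]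
  simp only [Pi.mul_apply, mul_comm]

theorem priorKernel_univ (t₀ : ι → ℝ) (W : Matrix ι ι ℝ) (n₀ : ℝ) :
    priorKernel t₀ W n₀ Set.univ = ∫⁻ θ, weighted t₀ W n₀ (fun _ => 1) θ := by
  rw [← lintegral_one, lintegral_priorKernel t₀ W n₀ measurable_const]

variable [DecidableEq ι]

instance : (volume : Measure (Param ι)).IsAddHaarMeasure :=
  Measure.prod.instIsAddHaarMeasure (volume : Measure (ι → ℝ)) (volume : Measure (Sym2 ι → ℝ))

theorem measurable_inv_apply {X κ : Type*} [TopologicalSpace X] [MeasurableSpace X]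
    [BorelSpace X] [Fintype κ] [DecidableEq κ] {A : X → Matrix κ κ ℝ} (hA : Continuous A)
    (i j : κ) : Measurable fun x => (A x)⁻¹ i j := by
  simp_rw [inv_def, Ring.inverse_eq_inv', Matrix.smul_apply, smul_eq_mul]
  exact hA.matrix_det.measurable.inv.mul (hA.matrix_adjugate.matrix_elem i j).measurable

theorem measurable_secondMoment_prod :
    Measurable fun p : (ι → ℝ) × Param ι => secondMoment p.1 p.2 := by
  have h1 : ∀ i j, Measurable fun p : (ι → ℝ) × Param ι => p.2.Lam⁻¹ i j := fun i j =>
    (measurable_inv_apply continuous_Lam i j).comp measurable_snd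
  have h2 : Measurable fun p : (ι → ℝ) × Param ι => p.2.eta := measurable_eta.comp measurable_snd
  exact (measurable_dotProduct_mulVec_of_apply measurable_fst h1 measurable_fst).add
    ((measurable_dotProduct_mulVec_of_apply measurable_fst h1 h2).pow_const 2)

theorem measurable_secondMoment (u : ι → ℝ) : Measurable (secondMoment u) :=
  measurable_secondMoment_prod.comp measurable_prodMk_left

theorem priorKernel_univ_ne_zero (t₀ : ι → ℝ) (W : Matrix ι ι ℝ) (n₀ : ℝ) :
    priorKernel t₀ W n₀ Set.univ ≠ 0 := by
  intro h
  rw [priorKernel_univ, lintegral_eq_zero_iff (measurable_weighted t₀ W n₀ measurable_const)] at h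
  have h1 : ∀ᵐ θ ∂(volume : Measure (Param ι)), θ ∉ posDefCone ι := by
    filter_upwards [h] with θ hθ hmem
    rw [weighted_of_posDef _ _ _ _ (mem_posDefCone.1 hmem), one_mul, Pi.zero_apply,
      ENNReal.ofReal_eq_zero] at hθ
    exact hθ.not_gt (Real.exp_pos _)
  rw [ae_iff] at h1
  simp only [not_not] at h1
  exact (isOpen_posDefCone.measure_pos volume posDefCone_nonempty).ne' h1

theorem posDef_line_iff {θ : Param ι} (h : θ.Lam.PosDef) {u : ι → ℝ} (hu : u ≠ 0) (τ : ℝ) :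
    (θ + (τ - (u ⬝ᵥ θ.Lam⁻¹ *ᵥ u)⁻¹) • Param.rankOne u).Lam.PosDef ↔ 0 < τ := by
  have hq := h.inv.dotProduct_pos hu
  rw [Param.Lam_add_rankOne, posDef_add_smul_vecMulVec_iff h hu, sub_mul, inv_mul_cancel₀ hq.ne']
  simp [hq]

/-! ### Integrating the prior over rank-one lines -/

section Line

variable {t₀ : ι → ℝ} {W : Matrix ι ι ℝ} {n₀ : ℝ} {u : ι → ℝ}

/-- The point is that `C` and `c`, which vary with the line, are the same in both integrals, so they
cancel when the two are compared. -/
theorem lintegral_priorDensity_line (hn : 0 < n₀) (hu : u ≠ 0) {θ : Param ι}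
    (h : θ.Lam.PosDef) :
    ∃ C c : ℝ, 0 < C ∧ 0 ≤ c ∧
    (∫⁻ s : ℝ, weighted t₀ W n₀ (fun _ => 1) (θ + s • Param.rankOne u) =
      ENNReal.ofReal C * ∫⁻ τ in Set.Ioi 0,
        ENNReal.ofReal (rayDensity (n₀ / 2) c (u ⬝ᵥ W *ᵥ u) τ)) ∧
    (∫⁻ s : ℝ, weighted t₀ W n₀ (fun θ => ENNReal.ofReal (secondMoment u θ))
      (θ + s • Param.rankOne u) =
      ENNReal.ofReal (2 / n₀) * (ENNReal.ofReal C * ∫⁻ τ in Set.Ioi 0,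
        ENNReal.ofReal ((n₀ / 2 / τ + c / τ ^ 2) *
          rayDensity (n₀ / 2) c (u ⬝ᵥ W *ᵥ u) τ))) := by
  obtain ⟨C, hC, hline⟩ := priorDensity_line t₀ W n₀ h hu
  set q := u ⬝ᵥ θ.Lam⁻¹ *ᵥ u with hq
  set c := n₀ / 2 * ((u ⬝ᵥ θ.Lam⁻¹ *ᵥ θ.eta) / q) ^ 2 with hc
  have hm := measurable_rayDensity (n₀ / 2) c (u ⬝ᵥ W *ᵥ u)
  refine ⟨C, c, hC, by positivity, ?_, ?_⟩
  · rw [← lintegral_const_mul _ (by fun_prop)]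
    refine lintegral_eq_lintegral_Ioi _ _ q⁻¹ (fun τ hτ => ?_) fun τ hτ => ?_
    · exact weighted_of_not_posDef _ _ _ _ fun h' => hτ.not_gt ((posDef_line_iff h hu τ).1 h')
    · rw [weighted_of_posDef _ _ _ _ ((posDef_line_iff h hu τ).2 hτ), hline τ hτ, one_mul, ENNReal.ofReal_mul hC.le]
  · rw [← lintegral_const_mul _ (by fun_prop), ← lintegral_const_mul _ (by fun_prop)]
    refine lintegral_eq_lintegral_Ioi _ _ q⁻¹ (fun τ hτ => ?_) fun τ hτ => ?_
    · exact weighted_of_not_posDef _ _ _ _ fun h' => hτ.not_gt ((posDef_line_iff h hu τ).1 h')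
    · rw [weighted_of_posDef _ _ _ _ ((posDef_line_iff h hu τ).2 hτ), hline τ hτ, secondMoment_line h hu hn hτ, ← hq, ← hc,
        ENNReal.ofReal_mul (by positivity), ENNReal.ofReal_mul hC.le,
        ENNReal.ofReal_mul (by positivity)]
      ring

/-- Finite total mass makes almost every line integral finite. If `uᵀWu ≤ 0`, every line meeting the
cone has infinite integral, so almost no line would meet it and the prior kernel would vanish. -/
theorem dotProduct_mulVec_pos_of_finite (hn : 0 < n₀) (hu : u ≠ 0)
    (hfin : priorKernel t₀ W n₀ Set.univ ≠ ∞) : 0 < u ⬝ᵥ W *ᵥ u := by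
  by_contra! hv
  obtain ⟨ℓ, hℓ, hℓw⟩ := exists_slice_coordinate hu
  have h1 := (priorKernel_univ t₀ W n₀).trans (lintegral_eq_lintegral_lines volume _ ℓ hℓ hℓw _
    (measurable_weighted t₀ W n₀ measurable_const))
  have hmeas := measurable_lintegral_line_weighted t₀ W n₀ (F := fun _ => 1) measurable_const
    (Param.rankOne u)
  have h2 := ae_lt_top hmeas (h1 ▸ hfin)
  refine priorKernel_univ_ne_zero t₀ W n₀ (h1.trans ?_)
  rw [lintegral_eq_zero_iff hmeas]
  filter_upwards [h2] with θ hθ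
  -- The base point `θ` may lie outside the cone although its line meets it; `lintegral_line_add`
  -- allows the base point to be moved inside.
  by_cases h : ∃ s₀ : ℝ, (θ + s₀ • Param.rankOne u).Lam.PosDef
  · obtain ⟨s₀, hs₀⟩ := h
    obtain ⟨C, c, hC, hc, hint, -⟩ := lintegral_priorDensity_line (t₀ := t₀) (W := W) hn hu hs₀
    rw [lintegral_line_add, lintegral_rayDensity_eq_top (by positivity) hc hv,
      ENNReal.mul_top (by simpa using hC)] at hint
    exact absurd hint hθ.ne
  · push Not at h
    simp [weighted_of_not_posDef _ _ _ _ (h _)]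

/-- The identity holds on each line separately, with a factor that does not depend on the line;
integrating over the slab of base points gives the global one. -/
theorem lintegral_secondMoment_priorKernel (hn : 0 < n₀)
    (hfin : priorKernel t₀ W n₀ Set.univ ≠ ∞) (u : ι → ℝ) :
    ∫⁻ θ, ENNReal.ofReal (secondMoment u θ) ∂(priorKernel t₀ W n₀) =
      ENNReal.ofReal (2 * (u ⬝ᵥ W *ᵥ u) / n₀) * priorKernel t₀ W n₀ Set.univ := by
  by_cases hu : u = 0
  · simp [hu, secondMoment]
  have hv := dotProduct_mulVec_pos_of_finite hn hu hfin
  obtain ⟨ℓ, hℓ, hℓw⟩ := exists_slice_coordinate hu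
  have hM := (measurable_secondMoment u).ennreal_ofReal
  rw [lintegral_priorKernel t₀ W n₀ hM, priorKernel_univ,
    lintegral_eq_lintegral_lines volume _ ℓ hℓ hℓw _ (measurable_weighted t₀ W n₀ hM),
    lintegral_eq_lintegral_lines volume _ ℓ hℓ hℓw _ (measurable_weighted t₀ W n₀ measurable_const),
    ← lintegral_const_mul _ (measurable_lintegral_line_weighted t₀ W n₀ measurable_const _)]
  refine lintegral_congr fun θ => ?_
  by_cases h : ∃ s₀ : ℝ, (θ + s₀ • Param.rankOne u).Lam.PosDef
  · obtain ⟨s₀, hs₀⟩ := h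
    obtain ⟨C, c, hC, hc, h1, h2⟩ := lintegral_priorDensity_line (t₀ := t₀) (W := W) hn hu hs₀
    rw [lintegral_line_add] at h1 h2
    rw [h1, h2, lintegral_rayDensity_moment (by positivity) hc hv, mul_div_right_comm,
      ENNReal.ofReal_mul (by positivity)]
    ring
  · push Not at h
    simp [weighted_of_not_posDef _ _ _ _ (h _)]

end Line

end BayesCV

namespace BayesCV

/-! ### Conjugacy of the prior -/

variable {ι : Type*} {M : ℕ}

/-- The linear natural parameter of the posterior. -/
def postT (t₀ : ι → ℝ) (D : Fin M → EuclideanSpace ℝ ι) : ι → ℝ := t₀ + ∑ m, (D m).ofLp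

/-- The matrix natural parameter of the posterior. -/
noncomputable def postW (W : Matrix ι ι ℝ) (D : Fin M → EuclideanSpace ℝ ι) : Matrix ι ι ℝ :=
  W + (1 / 2 : ℝ) • ∑ m, vecMulVec (D m).ofLp (D m).ofLp

theorem continuous_postW (W : Matrix ι ι ℝ) :
    Continuous (postW W : (Fin M → EuclideanSpace ℝ ι) → Matrix ι ι ℝ) := by
  refine continuous_matrix fun i j => ?_
  simp only [postW, Matrix.add_apply, Matrix.smul_apply, Matrix.sum_apply, vecMulVec_apply]
  fun_prop

variable [Fintype ι]

/-- The posterior second moment of `uᵀ x` for a new observation `x`. -/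
noncomputable def postMoment (W : Matrix ι ι ℝ) (n₀ : ℝ) (D : Fin M → EuclideanSpace ℝ ι)
    (u : ι → ℝ) : ℝ := 2 * (u ⬝ᵥ postW W D *ᵥ u) / (n₀ + M)

theorem measurable_postMoment (W : Matrix ι ι ℝ) (n₀ : ℝ)
    {U : (Fin M → EuclideanSpace ℝ ι) → ι → ℝ} (hU : Measurable U) :
    Measurable fun D => postMoment W n₀ D (U D) :=
  ((measurable_dotProduct_mulVec_of_apply hU (fun i j =>
    ((continuous_postW W).matrix_elem i j).measurable) hU).const_mul 2).div_const _

/-- The Gaussian density of one observation in canonical form. -/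
noncomputable def likelihoodDensity (θ : Param ι) (x : EuclideanSpace ℝ ι) : ℝ :=
  Real.exp (θ.eta ⬝ᵥ x.ofLp - (x.ofLp ⬝ᵥ θ.Lam *ᵥ x.ofLp) / 2 - logPartition θ)

theorem measurable_likelihoodDensity_prod :
    Measurable (Function.uncurry (likelihoodDensity (ι := ι))) := by
  have h0 : Continuous fun p : Param ι × EuclideanSpace ℝ ι => p.2.ofLp := by fun_prop
  have h1 : Continuous fun p : Param ι × EuclideanSpace ℝ ι =>
      p.2.ofLp ⬝ᵥ p.1.Lam *ᵥ p.2.ofLp :=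
    h0.dotProduct ((continuous_Lam.comp continuous_fst).matrix_mulVec h0)
  have h2 : Continuous fun p : Param ι × EuclideanSpace ℝ ι => p.1.eta ⬝ᵥ p.2.ofLp :=
    (continuous_fst.comp continuous_fst).dotProduct h0
  exact Real.measurable_exp.comp ((h2.sub (h1.div_const 2)).measurable.sub
    (measurable_logPartition.comp measurable_fst))

theorem measurable_likelihoodDensity (θ : Param ι) : Measurable (likelihoodDensity θ) :=
  measurable_likelihoodDensity_prod.of_uncurry_left

/-- The joint density of the data given the parameter. -/
noncomputable def dataDensity (θ : Param ι) (D : Fin M → EuclideanSpace ℝ ι) : ℝ :=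
  ∏ m, likelihoodDensity θ (D m)

theorem measurable_dataDensity_prod :
    Measurable (Function.uncurry (dataDensity (ι := ι) (M := M))) := by
  have h : ∀ m, Measurable fun p : Param ι × (Fin M → EuclideanSpace ℝ ι) => (p.1, p.2 m) :=
    fun m => measurable_fst.prodMk ((measurable_pi_apply m).comp measurable_snd)
  have h2 : Function.uncurry (dataDensity (ι := ι) (M := M)) =
      fun p => ∏ m, Function.uncurry likelihoodDensity (p.1, p.2 m) := rfl
  rw [h2]
  exact Finset.measurable_prod _ fun m _ => measurable_likelihoodDensity_prod.comp (h m)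

theorem measurable_dataDensity (θ : Param ι) :
    Measurable (dataDensity θ : (Fin M → EuclideanSpace ℝ ι) → ℝ) :=
  measurable_dataDensity_prod.of_uncurry_left

theorem priorDensity_pos (t₀ : ι → ℝ) (W : Matrix ι ι ℝ) (n₀ : ℝ) (θ : Param ι) :
    0 < priorDensity t₀ W n₀ θ := Real.exp_pos _

/-- Exponential family conjugacy: an observation `x` contributes `x` to the linear parameter, `½ x
xᵀ` to the matrix parameter and one copy of `-A`. -/
theorem priorDensity_mul_dataDensity (t₀ : ι → ℝ) (W : Matrix ι ι ℝ) (n₀ : ℝ) (θ : Param ι)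
    (D : Fin M → EuclideanSpace ℝ ι) :
    priorDensity t₀ W n₀ θ * dataDensity θ D =
      priorDensity (postT t₀ D) (postW W D) (n₀ + M) θ := by
  simp only [priorDensity, dataDensity, likelihoodDensity, postT, postW]
  rw [← Real.exp_sum, ← Real.exp_add]
  congr 1
  have h1 : ∀ x : ι → ℝ, ((vecMulVec x x)ᵀ * θ.Lam).trace = x ⬝ᵥ θ.Lam *ᵥ x := by
    intro x
    rw [transpose_vecMulVec, vecMulVec_mul, trace_vecMulVec, dotProduct_mulVec, dotProduct_comm]
  rw [transpose_add, transpose_smul, transpose_sum, Matrix.add_mul, trace_add, Matrix.smul_mul,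
    trace_smul, Matrix.sum_mul, trace_sum, add_dotProduct, sum_dotProduct]
  simp only [h1, Finset.sum_sub_distrib, Finset.sum_const, Finset.card_univ, Fintype.card_fin,
    nsmul_eq_mul, smul_eq_mul, ← Finset.sum_div, dotProduct_comm θ.eta]
  ring

theorem measurable_weighted_post (t₀ : ι → ℝ) (W : Matrix ι ι ℝ) (n₀ : ℝ)
    {Φ : (Fin M → EuclideanSpace ℝ ι) → Param ι → ℝ≥0∞} (hΦ : Measurable (Function.uncurry Φ)) :
    Measurable fun p : (Fin M → EuclideanSpace ℝ ι) × Param ι =>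
      weighted (postT t₀ p.1) (postW W p.1) (n₀ + M) (Φ p.1) p.2 := by
  have h1 : (fun p : (Fin M → EuclideanSpace ℝ ι) × Param ι =>
      weighted (postT t₀ p.1) (postW W p.1) (n₀ + M) (Φ p.1) p.2) =
      (Prod.snd ⁻¹' posDefCone ι).indicator fun p => Function.uncurry Φ p *
        ENNReal.ofReal (priorDensity t₀ W n₀ p.2 * dataDensity p.2 p.1) := by
    ext p
    by_cases hp : p.2.Lam.PosDef
    · rw [weighted_of_posDef _ _ _ _ hp, Set.indicator_of_mem (Set.mem_preimage.2 (mem_posDefCone.2 hp)),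
        priorDensity_mul_dataDensity]
      rfl
    · rw [weighted_of_not_posDef _ _ _ _ hp,
        Set.indicator_of_notMem fun h => hp (mem_posDefCone.1 (Set.mem_preimage.1 h))]
  have h2 : Measurable fun p : (Fin M → EuclideanSpace ℝ ι) × Param ι =>
      Function.uncurry dataDensity (p.2, p.1) :=
    measurable_dataDensity_prod.comp (measurable_snd.prodMk measurable_fst)
  have h3 : Measurable fun p : (Fin M → EuclideanSpace ℝ ι) × Param ι =>
    priorDensity t₀ W n₀ p.2 := (measurable_priorDensity t₀ W n₀).comp measurable_snd
  rw [h1]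
  exact (hΦ.mul (h3.mul h2).ennreal_ofReal).indicator (measurable_snd measurableSet_posDefCone)

theorem measurable_lintegral_post (t₀ : ι → ℝ) (W : Matrix ι ι ℝ) (n₀ : ℝ)
    {Φ : (Fin M → EuclideanSpace ℝ ι) → Param ι → ℝ≥0∞} (hΦ : Measurable (Function.uncurry Φ)) :
    Measurable fun D => ∫⁻ θ, Φ D θ ∂(priorKernel (postT t₀ D) (postW W D) (n₀ + M)) := by
  simp_rw [fun D => lintegral_priorKernel (postT t₀ D) (postW W D) (n₀ + M)
    (hΦ.of_uncurry_left (x := D))]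
  exact (measurable_weighted_post t₀ W n₀ hΦ).lintegral_prod_right'

theorem ae_prior_posDef (t₀ : ι → ℝ) (W : Matrix ι ι ℝ) (n₀ : ℝ) : ∀ᵐ θ ∂(prior t₀ W n₀), θ.Lam.PosDef :=
  Measure.ae_smul_measure (ae_priorKernel_posDef t₀ W n₀) _

variable [DecidableEq ι]

/-- Valid also outside the positive definite cone, where `likelihood` is not the intended Gaussian.
-/
instance (θ : Param ι) : IsProbabilityMeasure (likelihood θ) := by
  unfold likelihood; infer_instance

theorem pi_likelihood_eq_withDensity {θ : Param ι} (h : θ.Lam.PosDef) :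
    (Measure.pi fun _ : Fin M => likelihood θ) =
      volume.withDensity fun D => ENNReal.ofReal (dataDensity θ D) := by
  have h1 := likelihood_eq_withDensity h
  have hint : Integrable (likelihoodDensity θ) := by
    refine ⟨(measurable_likelihoodDensity θ).aestronglyMeasurable, ?_⟩
    have h0 : 0 ≤ᵐ[volume] likelihoodDensity θ := .of_forall fun x => (Real.exp_pos _).le
    rw [hasFiniteIntegral_iff_ofReal h0]
    have h2 : likelihood θ Set.univ = 1 := measure_univ
    rw [h1, withDensity_apply _ MeasurableSet.univ, Measure.restrict_univ] at h2
    exact h2.trans_lt ENNReal.one_lt_top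
  rw [h1]
  exact pi_withDensity_ofReal (fun _ : Fin M => (volume : Measure (EuclideanSpace ℝ ι)))
    (fun _ => likelihoodDensity θ) (fun _ _ => (Real.exp_pos _).le) fun _ => hint

/-- **Bayes' formula**: the prior is conjugate. -/
theorem lintegral_priorKernel_data (t₀ : ι → ℝ) (W : Matrix ι ι ℝ) (n₀ : ℝ)
    {Φ : (Fin M → EuclideanSpace ℝ ι) → Param ι → ℝ≥0∞} (hΦ : Measurable (Function.uncurry Φ)) :
    ∫⁻ θ, ∫⁻ D, Φ D θ ∂(Measure.pi fun _ : Fin M => likelihood θ) ∂(priorKernel t₀ W n₀) =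
      ∫⁻ D, ∫⁻ θ, Φ D θ ∂(priorKernel (postT t₀ D) (postW W D) (n₀ + M)) := by
  have hΦ1 : ∀ θ, Measurable fun D => Φ D θ := fun θ => hΦ.of_uncurry_right
  have hd : Measurable fun p : Param ι × (Fin M → EuclideanSpace ℝ ι) =>
      Φ p.2 p.1 * ENNReal.ofReal (dataDensity p.1 p.2) :=
    (hΦ.comp measurable_swap).mul measurable_dataDensity_prod.ennreal_ofReal
  calc _ = ∫⁻ θ, (∫⁻ D, Φ D θ * ENNReal.ofReal (dataDensity θ D)) ∂(priorKernel t₀ W n₀) := by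
        refine lintegral_congr_ae ?_
        filter_upwards [ae_priorKernel_posDef t₀ W n₀] with θ hθ
        rw [pi_likelihood_eq_withDensity hθ, lintegral_withDensity_eq_lintegral_mul _
          (measurable_dataDensity θ).ennreal_ofReal (hΦ1 θ)]
        simp only [Pi.mul_apply, mul_comm]
    _ = ∫⁻ θ, ∫⁻ D, weighted (postT t₀ D) (postW W D) (n₀ + M) (Φ D) θ := by
        rw [lintegral_priorKernel t₀ W n₀ hd.lintegral_prod_right']
        refine lintegral_congr fun θ => ?_
        by_cases hθ : θ.Lam.PosDef
        · have hm : Measurable fun D => Φ D θ * ENNReal.ofReal (dataDensity θ D) :=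
            (hΦ1 θ).mul (measurable_dataDensity θ).ennreal_ofReal
          rw [weighted_of_posDef _ _ _ _ hθ, ← lintegral_mul_const _ hm]
          refine lintegral_congr fun D => ?_
          rw [weighted_of_posDef _ _ _ _ hθ, ← priorDensity_mul_dataDensity,
            ENNReal.ofReal_mul (priorDensity_pos t₀ W n₀ θ).le]
          ring
        · simp [weighted_of_not_posDef _ _ _ _ hθ]
    _ = ∫⁻ D, ∫⁻ θ, weighted (postT t₀ D) (postW W D) (n₀ + M) (Φ D) θ :=
        (lintegral_lintegral_swap (measurable_weighted_post t₀ W n₀ hΦ).aemeasurable).symm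
    _ = _ := by
        refine lintegral_congr fun D => ?_
        rw [lintegral_priorKernel _ _ _ (hΦ.of_uncurry_left (x := D))]

/-- Needed for integration against `Measure.bind`. The family with the explicit density is
measurable in every parameter and agrees with the likelihoods on the cone, hence almost everywhere.
-/
theorem aemeasurable_data_prod (t₀ : ι → ℝ) (W : Matrix ι ι ℝ) (n₀ : ℝ) :
    AEMeasurable (fun θ : Param ι =>
      (Measure.pi fun _ : Fin M => likelihood θ).prod (likelihood θ)) (priorKernel t₀ W n₀) := by
  have hk : Measurable fun p : Param ι × ((Fin M → EuclideanSpace ℝ ι) × EuclideanSpace ℝ ι) =>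
      ENNReal.ofReal (dataDensity p.1 p.2.1) * ENNReal.ofReal (likelihoodDensity p.1 p.2.2) :=
    (measurable_dataDensity_prod.comp
      (measurable_fst.prodMk (measurable_fst.comp measurable_snd))).ennreal_ofReal.mul
    (measurable_likelihoodDensity_prod.comp
      (measurable_fst.prodMk (measurable_snd.comp measurable_snd))).ennreal_ofReal
  refine ⟨fun θ => (volume.prod volume).withDensity fun p =>
    ENNReal.ofReal (dataDensity θ p.1) * ENNReal.ofReal (likelihoodDensity θ p.2), ?_, ?_⟩
  · refine Measure.measurable_of_measurable_coe _ fun s hs => ?_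
    simp_rw [withDensity_apply _ hs]
    exact hk.lintegral_prod_right'
  · filter_upwards [ae_priorKernel_posDef t₀ W n₀] with θ hθ
    rw [pi_likelihood_eq_withDensity hθ, likelihood_eq_withDensity hθ]
    exact prod_withDensity (measurable_dataDensity θ).ennreal_ofReal
      (measurable_likelihoodDensity θ).ennreal_ofReal

section Prior

variable {t₀ : ι → ℝ} {W : Matrix ι ι ℝ} {n₀ : ℝ}

theorem isProbabilityMeasure_prior (hfin : priorKernel t₀ W n₀ Set.univ ≠ ∞) :
    IsProbabilityMeasure (prior t₀ W n₀) :=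
  ⟨by rw [prior, Measure.smul_apply, smul_eq_mul,
    ENNReal.inv_mul_cancel (priorKernel_univ_ne_zero t₀ W n₀) hfin]⟩

theorem lintegral_dataLaw {G : (Fin M → EuclideanSpace ℝ ι) × EuclideanSpace ℝ ι → ℝ≥0∞}
    (hG : Measurable G) :
    ∫⁻ ω, G ω ∂(dataLaw M (prior t₀ W n₀)) = ∫⁻ θ, ∫⁻ D, ∫⁻ x, G (D, x) ∂(likelihood θ)
      ∂(Measure.pi fun _ : Fin M => likelihood θ) ∂(prior t₀ W n₀) := by
  have h : AEMeasurable (fun θ : Param ι => (Measure.pi fun _ : Fin M => likelihood θ).prod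
      (likelihood θ)) (prior t₀ W n₀) := (aemeasurable_data_prod t₀ W n₀).smul_measure _
  rw [dataLaw, Measure.lintegral_bind h hG.aemeasurable]
  exact lintegral_congr fun θ => lintegral_prod _ hG.aemeasurable

theorem isProbabilityMeasure_dataLaw (hfin : priorKernel t₀ W n₀ Set.univ ≠ ∞) :
    IsProbabilityMeasure (dataLaw M (prior t₀ W n₀)) := by
  have := isProbabilityMeasure_prior hfin
  refine ⟨?_⟩
  rw [← lintegral_one, lintegral_dataLaw measurable_const]
  simp

theorem lintegral_prior_data {Φ : (Fin M → EuclideanSpace ℝ ι) → Param ι → ℝ≥0∞}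
    (hΦ : Measurable (Function.uncurry Φ)) :
    ∫⁻ θ, ∫⁻ D, Φ D θ ∂(Measure.pi fun _ : Fin M => likelihood θ) ∂(prior t₀ W n₀) =
      (priorKernel t₀ W n₀ Set.univ)⁻¹ *
        ∫⁻ D, ∫⁻ θ, Φ D θ ∂(priorKernel (postT t₀ D) (postW W D) (n₀ + M)) := by
  rw [prior, lintegral_smul_measure, lintegral_priorKernel_data t₀ W n₀ hΦ, smul_eq_mul]

/-- Bayes' formula with `Φ = 1`: the posterior normalizing constants integrate to the finite total
mass of the prior kernel. -/
theorem ae_priorKernel_post_ne_top (hfin : priorKernel t₀ W n₀ Set.univ ≠ ∞) :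
    ∀ᵐ D : Fin M → EuclideanSpace ℝ ι,
      priorKernel (postT t₀ D) (postW W D) (n₀ + M) Set.univ ≠ ∞ := by
  have h1 := lintegral_priorKernel_data (M := M) t₀ W n₀ (Φ := fun _ _ => 1) measurable_const
  have h2 := measurable_lintegral_post (M := M) t₀ W n₀ (Φ := fun _ _ => 1) measurable_const
  simp only [lintegral_const, measure_univ, one_mul] at h1 h2
  exact (ae_lt_top h2 (h1 ▸ hfin)).mono fun D hD => hD.ne

/-- After Bayes' formula both sides are integrals over the data of posterior kernels, where the
second moment formula applies with the updated parameters. Indicator weights `g` will give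
conditional expectations; vectors `U` depending on the data accommodate decision rules. -/
theorem lintegral_sum_secondMoment_data {κ : Type*} [Fintype κ] (hn : 0 < n₀)
    (hfin : priorKernel t₀ W n₀ Set.univ ≠ ∞)
    {U : κ → (Fin M → EuclideanSpace ℝ ι) → ι → ℝ} (hU : ∀ k, Measurable (U k))
    {g : (Fin M → EuclideanSpace ℝ ι) → ℝ≥0∞} (hg : Measurable g) :
    ∫⁻ θ, ∫⁻ D, g D * ∑ k, ENNReal.ofReal (secondMoment (U k D) θ)
        ∂(Measure.pi fun _ : Fin M => likelihood θ) ∂(prior t₀ W n₀) =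
      ∫⁻ ω, g ω.1 * ∑ k, ENNReal.ofReal (postMoment W n₀ ω.1 (U k ω.1))
        ∂(dataLaw M (prior t₀ W n₀)) := by
  have hr : Measurable fun D => ∑ k, ENNReal.ofReal (postMoment W n₀ D (U k D)) :=
    Finset.measurable_sum _ fun k _ => (measurable_postMoment W n₀ (hU k)).ennreal_ofReal
  have hM : Measurable fun p : (Fin M → EuclideanSpace ℝ ι) × Param ι =>
      ∑ k, ENNReal.ofReal (secondMoment (U k p.1) p.2) :=
    Finset.measurable_sum _ fun k _ => (measurable_secondMoment_prod.comp
      (((hU k).comp measurable_fst).prodMk measurable_snd)).ennreal_ofReal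
  have hΦ : Measurable (Function.uncurry fun (D : Fin M → EuclideanSpace ℝ ι) (θ : Param ι) =>
      g D * ∑ k, ENNReal.ofReal (secondMoment (U k D) θ)) :=
    (hg.comp measurable_fst).mul hM
  have hΨ : Measurable (Function.uncurry fun (D : Fin M → EuclideanSpace ℝ ι) (_ : Param ι) =>
      g D * ∑ k, ENNReal.ofReal (postMoment W n₀ D (U k D))) :=
    (hg.mul hr).comp measurable_fst
  have hG : Measurable fun ω : (Fin M → EuclideanSpace ℝ ι) × EuclideanSpace ℝ ι =>
      g ω.1 * ∑ k, ENNReal.ofReal (postMoment W n₀ ω.1 (U k ω.1)) :=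
    (hg.mul hr).comp measurable_fst
  rw [lintegral_dataLaw hG]
  simp only [lintegral_const, measure_univ, mul_one]
  rw [lintegral_prior_data hΦ, lintegral_prior_data hΨ]
  congr 1
  refine lintegral_congr_ae ?_
  filter_upwards [ae_priorKernel_post_ne_top hfin] with D hD
  rw [lintegral_const_mul _ (Finset.measurable_sum _ fun k _ =>
      (measurable_secondMoment (U k D)).ennreal_ofReal),
    lintegral_finsetSum _ fun k _ => (measurable_secondMoment (U k D)).ennreal_ofReal,
    lintegral_const, mul_assoc, Finset.sum_mul]
  congr 1
  refine Finset.sum_congr rfl fun k _ => ?_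
  rw [lintegral_secondMoment_priorKernel (by positivity) hD (U k D), postMoment]

theorem lintegral_secondMoment_data (hn : 0 < n₀) (hfin : priorKernel t₀ W n₀ Set.univ ≠ ∞)
    (u : ι → ℝ) {g : (Fin M → EuclideanSpace ℝ ι) → ℝ≥0∞} (hg : Measurable g) :
    ∫⁻ θ, ∫⁻ D, g D * ENNReal.ofReal (secondMoment u θ)
        ∂(Measure.pi fun _ : Fin M => likelihood θ) ∂(prior t₀ W n₀) =
      ∫⁻ ω, g ω.1 * ENNReal.ofReal (postMoment W n₀ ω.1 u) ∂(dataLaw M (prior t₀ W n₀)) := by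
  simpa using lintegral_sum_secondMoment_data (κ := Unit) hn hfin
    (fun _ => measurable_const (a := u)) hg

theorem lintegral_sq_dataLaw (hn : 0 < n₀) (hfin : priorKernel t₀ W n₀ Set.univ ≠ ∞) (u : ι → ℝ)
    {g : (Fin M → EuclideanSpace ℝ ι) → ℝ≥0∞} (hg : Measurable g) :
    ∫⁻ ω, g ω.1 * ENNReal.ofReal ((u ⬝ᵥ ω.2.ofLp) ^ 2) ∂(dataLaw M (prior t₀ W n₀)) =
      ∫⁻ ω, g ω.1 * ENNReal.ofReal (postMoment W n₀ ω.1 u) ∂(dataLaw M (prior t₀ W n₀)) := by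
  have hu : Measurable fun x : EuclideanSpace ℝ ι => ENNReal.ofReal ((u ⬝ᵥ x.ofLp) ^ 2) := by
    unfold dotProduct
    fun_prop
  have hG : Measurable fun ω : (Fin M → EuclideanSpace ℝ ι) × EuclideanSpace ℝ ι =>
      g ω.1 * ENNReal.ofReal ((u ⬝ᵥ ω.2.ofLp) ^ 2) :=
    (hg.comp measurable_fst).mul (hu.comp measurable_snd)
  rw [← lintegral_secondMoment_data hn hfin u hg,
    lintegral_dataLaw hG]
  refine lintegral_congr_ae ?_
  filter_upwards [ae_prior_posDef t₀ W n₀] with θ hθ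
  refine lintegral_congr fun D => ?_
  rw [lintegral_const_mul _ hu, lintegral_sq_likelihood hθ, secondMoment]

theorem lintegral_sq_dataLaw_lt_top (hn : 0 < n₀) (hfin : priorKernel t₀ W n₀ Set.univ ≠ ∞)
    (u : ι → ℝ) :
    ∫⁻ ω, ENNReal.ofReal ((u ⬝ᵥ ω.2.ofLp) ^ 2) ∂(dataLaw M (prior t₀ W n₀)) < ∞ := by
  have h1 := lintegral_sq_dataLaw (M := M) hn hfin u (g := fun _ => 1) measurable_const
  have h2 := lintegral_secondMoment_data (M := M) hn hfin u
    (g := fun _ => 1) measurable_const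
  simp only [one_mul] at h1 h2
  rw [h1, ← h2]
  simp only [lintegral_const, measure_univ, mul_one]
  rw [prior, lintegral_smul_measure, lintegral_secondMoment_priorKernel hn hfin, smul_eq_mul]
  exact ENNReal.mul_lt_top (ENNReal.inv_lt_top.2 (priorKernel_univ_ne_zero t₀ W n₀).bot_lt)
    (ENNReal.mul_lt_top ENNReal.ofReal_lt_top hfin.lt_top)

end Prior

end BayesCV

namespace BayesCV

/-! ### Posterior moments of a new observation -/

variable {ι : Type*} [Fintype ι] {M : ℕ}

theorem dotProduct_postW_mulVec (W : Matrix ι ι ℝ) (D : Fin M → EuclideanSpace ℝ ι)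
    (u w : ι → ℝ) :
    u ⬝ᵥ postW W D *ᵥ w =
      u ⬝ᵥ W *ᵥ w + (∑ m, (u ⬝ᵥ (D m).ofLp) * (w ⬝ᵥ (D m).ofLp)) / 2 := by
  have h : ∀ x : ι → ℝ, u ⬝ᵥ vecMulVec x x *ᵥ w = (u ⬝ᵥ x) * (w ⬝ᵥ x) := by
    intro x
    rw [vecMulVec_mulVec, dotProduct_comm w x]
    simp [dotProduct_smul, mul_comm]
  rw [postW, add_mulVec, dotProduct_add, smul_mulVec, dotProduct_smul, Matrix.sum_mulVec,
    dotProduct_sum]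
  simp only [h, smul_eq_mul]
  ring

theorem measurable_sq_snd (u : ι → ℝ) :
    Measurable fun ω : (Fin M → EuclideanSpace ℝ ι) × EuclideanSpace ℝ ι =>
      (u ⬝ᵥ ω.2.ofLp) ^ 2 := by
  have h : Measurable fun x : EuclideanSpace ℝ ι => (u ⬝ᵥ x.ofLp) ^ 2 := by
    unfold dotProduct
    fun_prop
  exact h.comp measurable_snd

theorem mul_eq_polarization (u w : ι → ℝ) :
    (fun ω : (Fin M → EuclideanSpace ℝ ι) × EuclideanSpace ℝ ι =>
      (u ⬝ᵥ ω.2.ofLp) * (w ⬝ᵥ ω.2.ofLp)) =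
    (1 / 2 : ℝ) • ((fun ω => ((u + w) ⬝ᵥ ω.2.ofLp) ^ 2) - (fun ω => (u ⬝ᵥ ω.2.ofLp) ^ 2) -
      fun ω => (w ⬝ᵥ ω.2.ofLp) ^ 2) := by
  ext ω
  simp only [Pi.smul_apply, Pi.sub_apply, add_dotProduct, smul_eq_mul]
  ring

variable [DecidableEq ι]

/-- The posterior second moment form `(u, w) ↦ E[(uᵀ x) (wᵀ x) | data]` for a new observation. -/
noncomputable def postForm (W : Matrix ι ι ℝ) (n₀ : ℝ) (D : Fin M → EuclideanSpace ℝ ι) :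
    LinearMap.BilinForm ℝ (ι → ℝ) :=
  (n₀ + M : ℝ)⁻¹ • (Matrix.toBilin' (postW W D) + Matrix.toBilin' (postW W D)ᵀ)

theorem postForm_apply (W : Matrix ι ι ℝ) (n₀ : ℝ) (D : Fin M → EuclideanSpace ℝ ι)
    (u w : ι → ℝ) :
    postForm W n₀ D u w =
      (u ⬝ᵥ postW W D *ᵥ w + w ⬝ᵥ postW W D *ᵥ u) / (n₀ + M) := by
  have h : u ⬝ᵥ (postW W D)ᵀ *ᵥ w = w ⬝ᵥ postW W D *ᵥ u := by
    rw [mulVec_transpose, dotProduct_comm, dotProduct_mulVec]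
  simp [postForm, Matrix.toBilin'_apply', h, div_eq_inv_mul, mul_add]

theorem postForm_comm (W : Matrix ι ι ℝ) (n₀ : ℝ) (D : Fin M → EuclideanSpace ℝ ι)
    (u w : ι → ℝ) : postForm W n₀ D u w = postForm W n₀ D w u := by
  rw [postForm_apply, postForm_apply, add_comm]

theorem postForm_self (W : Matrix ι ι ℝ) (n₀ : ℝ) (D : Fin M → EuclideanSpace ℝ ι)
    (u : ι → ℝ) : postForm W n₀ D u u = postMoment W n₀ D u := by
  rw [postForm_apply, postMoment, two_mul]

theorem continuous_postForm (W : Matrix ι ι ℝ) (n₀ : ℝ) (u w : ι → ℝ) :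
    Continuous fun D : Fin M → EuclideanSpace ℝ ι => postForm W n₀ D u w := by
  simp_rw [postForm_apply]
  exact ((continuous_const.dotProduct ((continuous_postW W).matrix_mulVec continuous_const)).add
    (continuous_const.dotProduct ((continuous_postW W).matrix_mulVec continuous_const))).div_const _

section Prior

variable {t₀ : ι → ℝ} {W : Matrix ι ι ℝ} {n₀ : ℝ}

/-- The prior part is already positive and the data add a sum of squares, so positivity holds for
every data set, not just almost every one. -/
theorem postMoment_pos (hn : 0 < n₀) (hfin : priorKernel t₀ W n₀ Set.univ ≠ ∞)
    (D : Fin M → EuclideanSpace ℝ ι) {u : ι → ℝ} (hu : u ≠ 0) : 0 < postMoment W n₀ D u := by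
  have h1 := dotProduct_mulVec_pos_of_finite hn hu hfin
  have h2 : 0 ≤ ∑ m, (u ⬝ᵥ (D m).ofLp) * (u ⬝ᵥ (D m).ofLp) :=
    Finset.sum_nonneg fun m _ => mul_self_nonneg _
  rw [postMoment, dotProduct_postW_mulVec]
  positivity

theorem postMoment_nonneg (hn : 0 < n₀) (hfin : priorKernel t₀ W n₀ Set.univ ≠ ∞)
    (D : Fin M → EuclideanSpace ℝ ι) (u : ι → ℝ) : 0 ≤ postMoment W n₀ D u := by
  by_cases hu : u = 0
  · simp [hu, postMoment]
  · exact (postMoment_pos hn hfin D hu).le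

theorem integrable_sq_dataLaw (hn : 0 < n₀) (hfin : priorKernel t₀ W n₀ Set.univ ≠ ∞)
    (u : ι → ℝ) :
    Integrable (fun ω => (u ⬝ᵥ ω.2.ofLp) ^ 2) (dataLaw M (prior t₀ W n₀)) := by
  refine ⟨(measurable_sq_snd u).aestronglyMeasurable, ?_⟩
  rw [hasFiniteIntegral_iff_ofReal (.of_forall fun ω => sq_nonneg _)]
  exact lintegral_sq_dataLaw_lt_top hn hfin u

theorem integrable_postMoment (hn : 0 < n₀) (hfin : priorKernel t₀ W n₀ Set.univ ≠ ∞)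
    (u : ι → ℝ) :
    Integrable (fun ω => postMoment W n₀ ω.1 u) (dataLaw M (prior t₀ W n₀)) := by
  have hm : Measurable fun D : Fin M → EuclideanSpace ℝ ι => postMoment W n₀ D u :=
    measurable_postMoment W n₀ measurable_const
  refine ⟨(hm.comp measurable_fst).aestronglyMeasurable, ?_⟩
  rw [hasFiniteIntegral_iff_ofReal (.of_forall fun ω => postMoment_nonneg hn hfin _ _)]
  have h := lintegral_sq_dataLaw (M := M) hn hfin u (g := fun _ => 1) measurable_const
  simp only [one_mul] at h
  rw [← h]
  exact lintegral_sq_dataLaw_lt_top hn hfin u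

/-- Sets of `dataSigma` are preimages of sets `B` of data, and `lintegral_sq_dataLaw` with `g` the
indicator of `B` is the defining identity of the conditional expectation. -/
theorem condExp_sq (hn : 0 < n₀) (hfin : priorKernel t₀ W n₀ Set.univ ≠ ∞) (u : ι → ℝ) :
    (dataLaw M (prior t₀ W n₀))[fun ω => (u ⬝ᵥ ω.2.ofLp) ^ 2 | dataSigma ι M]
      =ᵐ[dataLaw M (prior t₀ W n₀)] fun ω => postMoment W n₀ ω.1 u := by
  have := isProbabilityMeasure_dataLaw (M := M) hfin
  have hle : dataSigma ι M ≤ Prod.instMeasurableSpace := measurable_fst.comap_le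
  have hm : Measurable fun D : Fin M → EuclideanSpace ℝ ι => postMoment W n₀ D u :=
    measurable_postMoment W n₀ measurable_const
  refine (ae_eq_condExp_of_forall_setIntegral_eq hle (integrable_sq_dataLaw hn hfin u)
    (fun s _ _ => (integrable_postMoment hn hfin u).integrableOn) (fun s hs _ => ?_) ?_).symm
  · obtain ⟨B, hB, rfl⟩ := hs
    have hB' : MeasurableSet (Prod.fst ⁻¹' B :
      Set ((Fin M → EuclideanSpace ℝ ι) × EuclideanSpace ℝ ι)) := measurable_fst hB
    have key := lintegral_sq_dataLaw (M := M) hn hfin u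
      (g := B.indicator fun _ => 1) (measurable_const.indicator hB)
    have hind : ∀ (F : (Fin M → EuclideanSpace ℝ ι) × EuclideanSpace ℝ ι → ℝ≥0∞) ω,
        B.indicator (fun _ => (1 : ℝ≥0∞)) ω.1 * F ω = (Prod.fst ⁻¹' B).indicator F ω := by
      intro F ω
      by_cases h : ω.1 ∈ B
      · rw [Set.indicator_of_mem h, Set.indicator_of_mem (Set.mem_preimage.2 h), one_mul]
      · rw [Set.indicator_of_notMem h,
          Set.indicator_of_notMem fun h' => h (Set.mem_preimage.1 h'), zero_mul]
    rw [lintegral_congr (hind fun ω => ENNReal.ofReal ((u ⬝ᵥ ω.2.ofLp) ^ 2)),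
      lintegral_congr (hind fun ω => ENNReal.ofReal (postMoment W n₀ ω.1 u)),
      lintegral_indicator hB', lintegral_indicator hB'] at key
    rw [integral_eq_lintegral_of_nonneg_ae (.of_forall fun ω => postMoment_nonneg hn hfin _ _)
        (hm.comp measurable_fst).aestronglyMeasurable,
      integral_eq_lintegral_of_nonneg_ae (.of_forall fun ω => sq_nonneg _)
        (measurable_sq_snd u).aestronglyMeasurable, key]
  · exact (hm.comp (comap_measurable Prod.fst)).stronglyMeasurable.aestronglyMeasurable

theorem integrable_mul_dataLaw (hn : 0 < n₀) (hfin : priorKernel t₀ W n₀ Set.univ ≠ ∞)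
    (u w : ι → ℝ) :
    Integrable (fun ω => (u ⬝ᵥ ω.2.ofLp) * (w ⬝ᵥ ω.2.ofLp)) (dataLaw M (prior t₀ W n₀)) := by
  rw [mul_eq_polarization]
  exact (((integrable_sq_dataLaw hn hfin _).sub (integrable_sq_dataLaw hn hfin _)).sub
    (integrable_sq_dataLaw hn hfin _)).smul _

theorem condExp_mul (hn : 0 < n₀) (hfin : priorKernel t₀ W n₀ Set.univ ≠ ∞) (u w : ι → ℝ) :
    (dataLaw M (prior t₀ W n₀))[fun ω => (u ⬝ᵥ ω.2.ofLp) * (w ⬝ᵥ ω.2.ofLp) | dataSigma ι M]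
      =ᵐ[dataLaw M (prior t₀ W n₀)] fun ω => postForm W n₀ ω.1 u w := by
  rw [mul_eq_polarization]
  have i1 := integrable_sq_dataLaw (M := M) hn hfin (u + w)
  have i2 := integrable_sq_dataLaw (M := M) hn hfin u
  have i3 := integrable_sq_dataLaw (M := M) hn hfin w
  refine (condExp_smul _ _ _).trans ?_
  filter_upwards [condExp_sub (i1.sub i2) i3 (dataSigma ι M), condExp_sub i1 i2 (dataSigma ι M),
    condExp_sq (M := M) hn hfin (u + w), condExp_sq (M := M) hn hfin u,
    condExp_sq (M := M) hn hfin w] with ω h1 h2 h3 h4 h5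
  rw [Pi.smul_apply, h1, Pi.sub_apply, h2, Pi.sub_apply, h3, h4, h5, ← postForm_self,
    ← postForm_self, ← postForm_self]
  simp only [map_add, LinearMap.add_apply, smul_eq_mul]
  rw [postForm_comm W n₀ ω.1 w u]
  ring

end Prior

end BayesCV

namespace BayesCV

/-! ### Control variates and the optimal rule -/

variable {d L M : ℕ}

/-- The vector `v` with `vᵀ x = h i` for a stacked observation `x = [h, vec C]`. -/
def hVec (d L : ℕ) (i : Fin d) : Idx d L → ℝ := Pi.single (Sum.inl i) 1

/-- The vector `v` with `vᵀ x = C i l` for a stacked observation `x = [h, vec C]`. -/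
def cVec (l : Fin L) (i : Fin d) : Idx d L → ℝ := Pi.single (Sum.inr (l, i)) 1

/-- The vector `v` with `vᵀ x = (C a) i` for a stacked observation `x = [h, vec C]`. -/
def combVec (a : Fin L → ℝ) (i : Fin d) : Idx d L → ℝ := ∑ l, a l • cVec l i

theorem hVec_dotProduct (i : Fin d) (x : Obs d L) : hVec d L i ⬝ᵥ x.ofLp = Obs.h x i := by
  simp [hVec, Obs.h]

theorem cVec_dotProduct (l : Fin L) (i : Fin d) (x : Obs d L) :
    cVec l i ⬝ᵥ x.ofLp = Obs.C x i l := by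
  simp [cVec, Obs.C]

theorem hVec_add_combVec_dotProduct (a : Fin L → ℝ) (i : Fin d) (x : Obs d L) :
    (hVec d L i + combVec a i) ⬝ᵥ x.ofLp = (Obs.h x + Obs.C x *ᵥ a) i := by
  rw [add_dotProduct, hVec_dotProduct, combVec, sum_dotProduct]
  simp only [smul_dotProduct, cVec_dotProduct, smul_eq_mul]
  simp [mulVec, dotProduct, mul_comm]

theorem combVec_sub (a b : Fin L → ℝ) (i : Fin d) :
    combVec (a - b) i = combVec a i - combVec b i := by
  simp [combVec, sub_smul]

theorem combVec_apply (a : Fin L → ℝ) (i : Fin d) (l : Fin L) :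
    combVec a i (Sum.inr (l, i)) = a l := by
  simp [combVec, cVec, Pi.single_apply]

theorem combVec_ne_zero {a : Fin L → ℝ} (ha : a ≠ 0) (i : Fin d) : combVec a i ≠ 0 := by
  obtain ⟨l, hl⟩ := Function.ne_iff.1 ha
  intro h
  exact hl (by rw [← combVec_apply a i l, h]; rfl)

theorem measurable_combVec {X : Type*} [MeasurableSpace X] {δ : X → Fin L → ℝ}
    (hδ : Measurable δ) (i : Fin d) : Measurable fun x => combVec (δ x) i := by
  have h : ∀ l, Measurable fun x => δ x l := fun l => (measurable_pi_apply l).comp hδ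
  refine measurable_pi_iff.2 fun p => ?_
  simp only [combVec, Finset.sum_apply, Pi.smul_apply, smul_eq_mul]
  exact Finset.measurable_sum _ fun l _ => (h l).mul_const _

variable (W : Matrix (Idx d L) (Idx d L) ℝ) (n₀ : ℝ) (D : Fin M → Obs d L)

/-- The posterior mean of `Cᵀ C`. -/
noncomputable def meanCC : Matrix (Fin L) (Fin L) ℝ :=
  Matrix.of fun l k => ∑ i, postForm W n₀ D (cVec l i) (cVec k i)

/-- The posterior mean of `Cᵀ h`. -/
noncomputable def meanCh : Fin L → ℝ :=
  fun l => ∑ i, postForm W n₀ D (cVec l i) (hVec d L i)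

/-- The posterior mean of `‖h + C a‖²`. -/
noncomputable def postRisk (a : Fin L → ℝ) : ℝ :=
  ∑ i, postMoment W n₀ D (hVec d L i + combVec a i)

/-- The decision rule minimizing the posterior risk. -/
noncomputable def bayesRule : Fin L → ℝ := -((meanCC W n₀ D)⁻¹ *ᵥ meanCh W n₀ D)

theorem sum_postForm_combVec_combVec (a b : Fin L → ℝ) :
    ∑ i, postForm W n₀ D (combVec b i) (combVec a i) = b ⬝ᵥ meanCC W n₀ D *ᵥ a := by
  have h : ∀ i : Fin d, postForm W n₀ D (combVec b i) (combVec a i) =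
      ∑ l, ∑ k, b l * (postForm W n₀ D (cVec l i) (cVec k i) * a k) := by
    intro i
    simp only [combVec, map_sum, map_smul, LinearMap.sum_apply, LinearMap.smul_apply, smul_eq_mul,
      Finset.mul_sum]
    rw [Finset.sum_comm]
    refine Finset.sum_congr rfl fun l _ => Finset.sum_congr rfl fun k _ => ?_
    ring
  simp_rw [h]
  rw [Finset.sum_comm, dotProduct]
  refine Finset.sum_congr rfl fun l _ => ?_
  rw [Finset.sum_comm, mulVec, dotProduct, Finset.mul_sum]
  refine Finset.sum_congr rfl fun k _ => ?_
  rw [meanCC, of_apply, Finset.sum_mul, Finset.mul_sum]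

theorem sum_postForm_combVec_hVec (b : Fin L → ℝ) :
    ∑ i, postForm W n₀ D (combVec b i) (hVec d L i) = b ⬝ᵥ meanCh W n₀ D := by
  simp only [combVec, map_sum, map_smul, LinearMap.sum_apply, LinearMap.smul_apply, smul_eq_mul,
    dotProduct, meanCh, Finset.mul_sum]
  rw [Finset.sum_comm]

theorem isSymm_meanCC : (meanCC W n₀ D).IsSymm := by
  ext l k
  simp [meanCC, postForm_comm W n₀ D (cVec l _)]

theorem continuous_meanCC : Continuous (meanCC W n₀ : (Fin M → Obs d L) → _) :=
  continuous_matrix fun l k => continuous_finsetSum Finset.univ fun i _ =>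
    continuous_postForm W n₀ (cVec l i) (cVec k i)

theorem measurable_bayesRule :
    Measurable (bayesRule W n₀ : (Fin M → Obs d L) → _) := by
  refine measurable_pi_iff.2 fun l => Measurable.neg ?_
  have h : ∀ k, Measurable fun D : Fin M → Obs d L => meanCh W n₀ D k := fun k =>
    (continuous_finsetSum Finset.univ fun i _ =>
      continuous_postForm W n₀ (cVec k i) (hVec d L i)).measurable
  exact Finset.measurable_sum Finset.univ
    (f := fun k (D : Fin M → Obs d L) => (meanCC W n₀ D)⁻¹ l k * meanCh W n₀ D k) fun k _ =>
    (measurable_inv_apply (continuous_meanCC (M := M) W n₀) l k).mul (h k)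

variable {W n₀} {t₀ : Idx d L → ℝ}

/-- The quadratic form at `a` is the sum over `i` of the posterior second moments of `(C a) i`, each
positive for `a ≠ 0`; `d > 0` makes the sum nonempty. -/
theorem posDef_meanCC (hd : 0 < d) (hn : 0 < n₀) (hfin : priorKernel t₀ W n₀ Set.univ ≠ ∞) :
    (meanCC W n₀ D).PosDef := by
  refine posDef_of_dotProduct_pos (isSymm_meanCC W n₀ D) fun a ha => ?_
  rw [← sum_postForm_combVec_combVec]
  have : Nonempty (Fin d) := ⟨⟨0, hd⟩⟩
  refine Finset.sum_pos (fun i _ => ?_) Finset.univ_nonempty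
  rw [postForm_self]
  exact postMoment_pos hn hfin D (combVec_ne_zero ha i)

theorem postRisk_nonneg (hn : 0 < n₀) (hfin : priorKernel t₀ W n₀ Set.univ ≠ ∞)
    (a : Fin L → ℝ) : 0 ≤ postRisk W n₀ D a :=
  Finset.sum_nonneg fun _ _ => postMoment_nonneg hn hfin D _

/-- Expansion around `bayesRule`, where the linear term vanishes by the normal equation `h3`. -/
theorem postRisk_eq (h : (meanCC W n₀ D).PosDef) (a : Fin L → ℝ) :
    postRisk W n₀ D a = postRisk W n₀ D (bayesRule W n₀ D) +
      (a - bayesRule W n₀ D) ⬝ᵥ meanCC W n₀ D *ᵥ (a - bayesRule W n₀ D) := by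
  set b := bayesRule W n₀ D with hb
  have h1 : ∀ i : Fin d, postMoment W n₀ D (hVec d L i + combVec a i) =
      postMoment W n₀ D (hVec d L i + combVec b i) +
        (2 * (postForm W n₀ D (combVec (a - b) i) (hVec d L i) +
          postForm W n₀ D (combVec (a - b) i) (combVec b i)) +
        postForm W n₀ D (combVec (a - b) i) (combVec (a - b) i)) := by
    intro i
    have h2 : hVec d L i + combVec a i = hVec d L i + combVec b i + combVec (a - b) i := by
      rw [combVec_sub]; abel
    rw [h2, ← postForm_self, ← postForm_self]
    simp only [map_add, LinearMap.add_apply]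
    rw [postForm_comm W n₀ D (hVec d L i) (combVec (a - b) i),
      postForm_comm W n₀ D (combVec b i) (combVec (a - b) i)]
    ring
  have h3 : meanCh W n₀ D + meanCC W n₀ D *ᵥ b = 0 := by
    rw [hb, bayesRule, mulVec_neg, h.mulVec_inv, add_neg_cancel]
  unfold postRisk
  simp only [h1, Finset.sum_add_distrib, ← Finset.mul_sum, sum_postForm_combVec_combVec,
    sum_postForm_combVec_hVec]
  rw [← dotProduct_add, h3, dotProduct_zero, mul_zero, zero_add]

theorem loss_eq {θ : Param (Idx d L)} (hθ : θ.Lam.PosDef) (a : Fin L → ℝ) :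
    loss a θ = ∑ i, ENNReal.ofReal (secondMoment (hVec d L i + combVec a i) θ) := by
  have h1 : ∀ x : Obs d L, ‖WithLp.toLp 2 (Obs.h x + Obs.C x *ᵥ a)‖ₑ ^ 2 =
      ∑ i, ENNReal.ofReal (((hVec d L i + combVec a i) ⬝ᵥ x.ofLp) ^ 2) := by
    intro x
    rw [← ENNReal.ofReal_sum_of_nonneg fun i _ => sq_nonneg _, ← ofReal_norm,
      ← ENNReal.ofReal_pow (norm_nonneg _), EuclideanSpace.real_norm_sq_eq]
    simp_rw [hVec_add_combVec_dotProduct]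
  have hm : ∀ u : Idx d L → ℝ, Measurable fun x : Obs d L =>
      ENNReal.ofReal ((u ⬝ᵥ x.ofLp) ^ 2) := by
    intro u
    unfold dotProduct
    fun_prop
  rw [loss, lintegral_congr h1, lintegral_finsetSum _ fun i _ => hm _]
  exact Finset.sum_congr rfl fun i _ => lintegral_sq_likelihood hθ _

theorem bayesRegret_eq (hn : 0 < n₀) (hfin : priorKernel t₀ W n₀ Set.univ ≠ ∞)
    {δ : (Fin M → Obs d L) → Fin L → ℝ} (hδ : Measurable δ) :
    bayesRegret (prior t₀ W n₀) δ =
      ∫⁻ ω, ENNReal.ofReal (postRisk W n₀ ω.1 (δ ω.1)) ∂(dataLaw M (prior t₀ W n₀)) := by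
  have h := lintegral_sum_secondMoment_data (M := M) hn hfin
    (U := fun i D => hVec d L i + combVec (δ D) i)
    (fun i => measurable_const.add (measurable_combVec hδ i)) (g := fun _ => 1) measurable_const
  simp only [one_mul] at h
  have h1 : ∀ ω : (Fin M → Obs d L) × Obs d L, ENNReal.ofReal (postRisk W n₀ ω.1 (δ ω.1)) =
      ∑ i, ENNReal.ofReal (postMoment W n₀ ω.1 (hVec d L i + combVec (δ ω.1) i)) := fun ω =>
    ENNReal.ofReal_sum_of_nonneg fun i _ => postMoment_nonneg hn hfin _ _
  rw [lintegral_congr h1, ← h]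
  refine lintegral_congr_ae ?_
  filter_upwards [ae_prior_posDef t₀ W n₀] with θ hθ
  exact lintegral_congr fun D => loss_eq hθ _

theorem measurable_postRisk {δ : (Fin M → Obs d L) → Fin L → ℝ} (hδ : Measurable δ) :
    Measurable fun D => postRisk W n₀ D (δ D) :=
  Finset.measurable_sum _ fun i _ =>
    measurable_postMoment W n₀ (measurable_const.add (measurable_combVec hδ i))

theorem bayesRegret_eq_add (hd : 0 < d) (hn : 0 < n₀)
    (hfin : priorKernel t₀ W n₀ Set.univ ≠ ∞) {δ : (Fin M → Obs d L) → Fin L → ℝ}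
    (hδ : Measurable δ) :
    bayesRegret (prior t₀ W n₀) δ = bayesRegret (prior t₀ W n₀) (bayesRule (M := M) W n₀) +
      ∫⁻ ω, ENNReal.ofReal ((δ ω.1 - bayesRule W n₀ ω.1) ⬝ᵥ meanCC W n₀ ω.1 *ᵥ
        (δ ω.1 - bayesRule W n₀ ω.1)) ∂(dataLaw M (prior t₀ W n₀)) := by
  have hb := measurable_bayesRule (M := M) W n₀
  have hm : Measurable fun ω : (Fin M → Obs d L) × Obs d L =>
      postRisk W n₀ ω.1 (bayesRule W n₀ ω.1) := (measurable_postRisk hb).comp measurable_fst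
  rw [bayesRegret_eq hn hfin hδ, bayesRegret_eq hn hfin hb, ← lintegral_add_left]
  · refine lintegral_congr fun ω => ?_
    have hpd := posDef_meanCC ω.1 hd hn hfin
    rw [postRisk_eq ω.1 hpd, ENNReal.ofReal_add (postRisk_nonneg ω.1 hn hfin _)]
    simpa using hpd.posSemidef.dotProduct_mulVec_nonneg (δ ω.1 - bayesRule W n₀ ω.1)
  · exact hm.ennreal_ofReal

/-- Comparison with the zero rule, whose posterior risk is integrable. Finiteness is what permits
cancellation in the uniqueness argument. -/
theorem bayesRegret_bayesRule_ne_top (hd : 0 < d) (hn : 0 < n₀)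
    (hfin : priorKernel t₀ W n₀ Set.univ ≠ ∞) :
    bayesRegret (prior t₀ W n₀) (bayesRule (M := M) W n₀) ≠ ∞ := by
  have h1 := bayesRegret_eq_add (M := M) hd hn hfin (measurable_const (a := 0))
  have h2 : bayesRegret (prior t₀ W n₀) (fun _ : Fin M → Obs d L => (0 : Fin L → ℝ)) ≠ ∞ := by
    rw [bayesRegret_eq hn hfin measurable_const]
    have hint : Integrable (fun ω => postRisk W n₀ ω.1 0) (dataLaw M (prior t₀ W n₀)) :=
      integrable_finsetSum _ fun i _ => integrable_postMoment hn hfin _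
    rw [← ofReal_integral_eq_lintegral_ofReal hint
      (.of_forall fun ω => postRisk_nonneg ω.1 hn hfin _)]
    exact ENNReal.ofReal_ne_top
  exact ne_top_of_le_ne_top h2 (h1 ▸ le_self_add)

theorem isOptimalRule_bayesRule (hd : 0 < d) (hn : 0 < n₀)
    (hfin : priorKernel t₀ W n₀ Set.univ ≠ ∞) :
    IsOptimalRule (prior t₀ W n₀) (bayesRule (M := M) W n₀) :=
  ⟨measurable_bayesRule W n₀, fun _ hδ => by
    rw [bayesRegret_eq_add hd hn hfin hδ]; exact le_self_add⟩

theorem isOptimalRule_iff (hd : 0 < d) (hn : 0 < n₀)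
    (hfin : priorKernel t₀ W n₀ Set.univ ≠ ∞) {δ : (Fin M → Obs d L) → Fin L → ℝ}
    (hδ : Measurable δ) :
    IsOptimalRule (prior t₀ W n₀) δ ↔
      ∀ᵐ ω ∂(dataLaw M (prior t₀ W n₀)), δ ω.1 = bayesRule W n₀ ω.1 := by
  have hb := measurable_bayesRule (M := M) W n₀
  have hopt := isOptimalRule_bayesRule (M := M) hd hn hfin
  have hdiff : Measurable fun D => δ D - bayesRule W n₀ D := hδ.sub hb
  have hq : Measurable fun D => (δ D - bayesRule W n₀ D) ⬝ᵥ meanCC W n₀ D *ᵥ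
      (δ D - bayesRule W n₀ D) :=
    measurable_dotProduct_mulVec_of_apply hdiff
      (fun l k => ((continuous_meanCC W n₀).matrix_elem l k).measurable) hdiff
  have hq' : Measurable fun ω : (Fin M → Obs d L) × Obs d L =>
      ENNReal.ofReal ((δ ω.1 - bayesRule W n₀ ω.1) ⬝ᵥ meanCC W n₀ ω.1 *ᵥ
        (δ ω.1 - bayesRule W n₀ ω.1)) := (hq.comp measurable_fst).ennreal_ofReal
  have h1 : IsOptimalRule (prior t₀ W n₀) δ ↔ bayesRegret (prior t₀ W n₀) δ ≤
      bayesRegret (prior t₀ W n₀) (bayesRule (M := M) W n₀) :=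
    ⟨fun h => h.2 _ hb, fun h => ⟨hδ, fun δ' hδ' => h.trans (hopt.2 δ' hδ')⟩⟩
  have h2 : ∀ x y : ℝ≥0∞, x ≠ ∞ → (x + y ≤ x ↔ y = 0) := by
    intro x y hx
    refine ⟨fun h => ?_, fun h => by simp [h]⟩
    have h3 : x + y ≤ x + 0 := by simpa using h
    simpa using (ENNReal.add_le_add_iff_left hx).1 h3
  rw [h1, bayesRegret_eq_add hd hn hfin hδ, h2 _ _ (bayesRegret_bayesRule_ne_top hd hn hfin)]
  refine (lintegral_eq_zero_iff hq').trans ⟨fun h => ?_, fun h => ?_⟩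
  · filter_upwards [h] with ω hω
    by_contra hne
    have := (posDef_meanCC ω.1 hd hn hfin).dotProduct_pos (sub_ne_zero.2 hne)
    exact (ENNReal.ofReal_pos.2 this).ne' hω
  · filter_upwards [h] with ω hω
    simp [hω]

/-! ### Posterior expectations in closed form -/

theorem transpose_mul_apply_eq (x : Obs d L) (l k : Fin L) :
    ((Obs.C x)ᵀ * Obs.C x) l k = ∑ i, (cVec l i ⬝ᵥ x.ofLp) * (cVec k i ⬝ᵥ x.ofLp) := by
  simp [Matrix.mul_apply, cVec_dotProduct]

theorem transpose_mulVec_apply_eq (x : Obs d L) (l : Fin L) :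
    ((Obs.C x)ᵀ *ᵥ Obs.h x) l = ∑ i, (cVec l i ⬝ᵥ x.ofLp) * (hVec d L i ⬝ᵥ x.ofLp) := by
  simp only [cVec_dotProduct, hVec_dotProduct]
  rfl

theorem condExp_sum_mul {ι κ : Type*} [Fintype ι] [DecidableEq ι] [Fintype κ] {t₀ : ι → ℝ}
    {W : Matrix ι ι ℝ} (hn : 0 < n₀) (hfin : priorKernel t₀ W n₀ Set.univ ≠ ∞)
    (u w : κ → ι → ℝ) :
    (dataLaw M (prior t₀ W n₀))[fun ω => ∑ i, (u i ⬝ᵥ ω.2.ofLp) * (w i ⬝ᵥ ω.2.ofLp) |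
        dataSigma ι M]
      =ᵐ[dataLaw M (prior t₀ W n₀)] fun ω => ∑ i, postForm W n₀ ω.1 (u i) (w i) := by
  have h1 : (fun ω : (Fin M → EuclideanSpace ℝ ι) × EuclideanSpace ℝ ι =>
      ∑ i, (u i ⬝ᵥ ω.2.ofLp) * (w i ⬝ᵥ ω.2.ofLp)) =
      ∑ i, fun ω => (u i ⬝ᵥ ω.2.ofLp) * (w i ⬝ᵥ ω.2.ofLp) := by
    ext ω
    simp
  rw [h1]
  refine (condExp_finsetSum (fun i _ => integrable_mul_dataLaw hn hfin (u i) (w i)) _).trans ?_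
  filter_upwards [ae_all_iff.2 fun i => condExp_mul (M := M) hn hfin (u i) (w i)] with ω hω
  simp [hω]

theorem postCC_ae_eq (hn : 0 < n₀) (hfin : priorKernel t₀ W n₀ Set.univ ≠ ∞) :
    ∀ᵐ ω ∂(dataLaw M (prior t₀ W n₀)),
      postCC M (prior t₀ W n₀) ω = meanCC W n₀ ω.1 := by
  filter_upwards [ae_all_iff.2 fun l : Fin L => ae_all_iff.2 fun k : Fin L =>
    condExp_sum_mul (M := M) hn hfin (cVec l) (cVec (d := d) k)] with ω hω
  ext l k
  simp only [postCC, transpose_mul_apply_eq, of_apply]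
  exact hω l k

theorem postCh_ae_eq (hn : 0 < n₀) (hfin : priorKernel t₀ W n₀ Set.univ ≠ ∞) :
    ∀ᵐ ω ∂(dataLaw M (prior t₀ W n₀)),
      postCh M (prior t₀ W n₀) ω = meanCh W n₀ ω.1 := by
  filter_upwards [ae_all_iff.2 fun l : Fin L =>
    condExp_sum_mul (M := M) hn hfin (cVec l) (hVec d L)] with ω hω
  ext l
  simp only [postCh, transpose_mulVec_apply_eq]
  exact hω l

/-- `W = V / 2` cancels the factor `2` of the moment formula. Diagonal blocks of `V` may be
nonsymmetric, so the symmetrized entries appear; the traces do not see the difference. -/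
theorem postForm_half_single {ι : Type*} [Fintype ι] [DecidableEq ι] (V : Matrix ι ι ℝ)
    (D : Fin M → EuclideanSpace ℝ ι) (p q : ι) :
    postForm ((1 / 2 : ℝ) • V) n₀ D (Pi.single p 1) (Pi.single q 1) =
      ((V p q + V q p) / 2 + ∑ m, D m p * D m q) / (n₀ + M) := by
  rw [postForm_apply, dotProduct_postW_mulVec, dotProduct_postW_mulVec]
  simp only [single_one_dotProduct, mulVec_single_one, Matrix.col_apply, Matrix.smul_apply,
    smul_eq_mul, mul_comm]
  ring

/-- For `M = 0` the inverse `(M : ℝ)⁻¹` is `0`, so `y` must vanish; in the applications it is then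
an empty sum. -/
theorem kappa_identity (hn : 0 < n₀) (x y : ℝ) (hy : M = 0 → y = 0) :
    (x + y) / (n₀ + M) = n₀ / (n₀ + M) / n₀ * x + (1 - n₀ / (n₀ + M)) * ((M : ℝ)⁻¹ * y) := by
  have h : (0 : ℝ) < n₀ + M := by positivity
  rcases Nat.eq_zero_or_pos M with hM | hM
  · rw [hy hM]
    field_simp
    ring
  · have hM' : (0 : ℝ) < M := by exact_mod_cast hM
    field_simp
    ring

theorem HasBlockForm.trace_blockCC_comm {V : Matrix (Idx d L) (Idx d L) ℝ} (hV : HasBlockForm V)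
    (l k : Fin L) : (blockCC V k l).trace = (blockCC V l k).trace := by
  rcases lt_trichotomy l k with h | rfl | h
  · rw [hV.2 k l h, trace_transpose]
  · rfl
  · rw [hV.2 l k h, trace_transpose]

theorem meanCC_eq (hn : 0 < n₀) {V : Matrix (Idx d L) (Idx d L) ℝ} (hV : HasBlockForm V) :
    meanCC ((1 / 2 : ℝ) • V) n₀ D =
      (n₀ / (n₀ + M) / n₀) • Matrix.of (fun l k => (blockCC V l k).trace) +
        (1 - n₀ / (n₀ + M)) • empCC D := by
  ext l k
  have h1 : ∑ i : Fin d, (V (Sum.inr (l, i)) (Sum.inr (k, i)) +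
      V (Sum.inr (k, i)) (Sum.inr (l, i))) / 2 = (blockCC V l k).trace := by
    have h2 := hV.trace_blockCC_comm l k
    have h3 : ∑ i : Fin d, (V (Sum.inr (l, i)) (Sum.inr (k, i)) +
        V (Sum.inr (k, i)) (Sum.inr (l, i))) / 2 =
        ((blockCC V l k).trace + (blockCC V k l).trace) / 2 := by
      rw [← Finset.sum_div, Finset.sum_add_distrib]
      rfl
    rw [h3, h2]
    ring
  have h4 : empCC D l k = (M : ℝ)⁻¹ * ∑ i, ∑ m, D m (Sum.inr (l, i)) * D m (Sum.inr (k, i)) := by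
    rw [empCC, Matrix.smul_apply, Matrix.sum_apply, Finset.sum_comm, smul_eq_mul]
    rfl
  simp only [meanCC, cVec, of_apply, postForm_half_single, Matrix.add_apply, Matrix.smul_apply,
    smul_eq_mul, h4]
  rw [← Finset.sum_div, Finset.sum_add_distrib, h1]
  refine kappa_identity hn _ _ fun hM => ?_
  subst hM
  simp

theorem meanCh_eq (hn : 0 < n₀) {V : Matrix (Idx d L) (Idx d L) ℝ} (hV : HasBlockForm V) :
    meanCh ((1 / 2 : ℝ) • V) n₀ D =
      (n₀ / (n₀ + M) / n₀) • (fun l => (blockHC V l).trace) +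
        (1 - n₀ / (n₀ + M)) • empCh D := by
  ext l
  have h1 : ∑ i : Fin d, (V (Sum.inr (l, i)) (Sum.inl i) + V (Sum.inl i) (Sum.inr (l, i))) / 2 =
      (blockHC V l).trace := by
    have h2 : ∀ i : Fin d, V (Sum.inl i) (Sum.inr (l, i)) = V (Sum.inr (l, i)) (Sum.inl i) :=
      fun i => congrFun (congrFun (hV.1 l) i) i
    simp only [h2, add_self_div_two]
    rfl
  have h4 : empCh D l = (M : ℝ)⁻¹ * ∑ i, ∑ m, D m (Sum.inr (l, i)) * D m (Sum.inl i) := by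
    rw [empCh, Pi.smul_apply, Finset.sum_apply, Finset.sum_comm, smul_eq_mul]
    rfl
  simp only [meanCh, cVec, hVec, postForm_half_single, Pi.add_apply, Pi.smul_apply,
    smul_eq_mul, h4]
  rw [← Finset.sum_div, Finset.sum_add_distrib, h1]
  refine kappa_identity hn _ _ fun hM => ?_
  subst hM
  simp

end BayesCV

theorem mainTheorem2 (d L M : ℕ) (hd : 0 < d)
    (t₀ : BayesCV.Idx d L → ℝ) (V₀ : Matrix (BayesCV.Idx d L) (BayesCV.Idx d L) ℝ) (n₀ : ℝ)
    (hn₀ : 0 < n₀) (hV₀ : BayesCV.HasBlockForm V₀)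
    (hproper : BayesCV.priorKernel t₀ ((1 / 2 : ℝ) • V₀) n₀ Set.univ ≠ ∞)
    (π : Measure (BayesCV.Param (BayesCV.Idx d L)))
    (hπ : π = BayesCV.prior t₀ ((1 / 2 : ℝ) • V₀) n₀)
    (κ : ℝ) (hκ : κ = n₀ / (n₀ + M)) :
    IsProbabilityMeasure π ∧
    IsProbabilityMeasure (BayesCV.dataLaw M π) ∧
    -- the posterior expectations exist, and the matrix to be inverted is invertible
    (∀ l k : Fin L, Integrable (fun ω : (Fin M → BayesCV.Obs d L) × BayesCV.Obs d L =>
      ((BayesCV.Obs.C ω.2)ᵀ * BayesCV.Obs.C ω.2) l k) (BayesCV.dataLaw M π)) ∧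
    (∀ l : Fin L, Integrable (fun ω : (Fin M → BayesCV.Obs d L) × BayesCV.Obs d L =>
      ((BayesCV.Obs.C ω.2)ᵀ *ᵥ BayesCV.Obs.h ω.2) l) (BayesCV.dataLaw M π)) ∧
    (∀ᵐ ω ∂(BayesCV.dataLaw M π), IsUnit (BayesCV.postCC M π ω).det) ∧
    -- the optimal decision rule
    (∃ δ : (Fin M → BayesCV.Obs d L) → (Fin L → ℝ), BayesCV.IsOptimalRule π δ) ∧
    (∀ δ : (Fin M → BayesCV.Obs d L) → (Fin L → ℝ), Measurable δ →
      (BayesCV.IsOptimalRule π δ ↔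
        ∀ᵐ ω ∂(BayesCV.dataLaw M π),
          δ ω.1 = -((BayesCV.postCC M π ω)⁻¹ *ᵥ BayesCV.postCh M π ω))) ∧
    -- the posterior expectations in closed form
    (∀ᵐ ω ∂(BayesCV.dataLaw M π),
      BayesCV.postCh M π ω =
        (κ / n₀) • (fun l => (BayesCV.blockHC V₀ l).trace) + (1 - κ) • BayesCV.empCh ω.1) ∧
    (∀ᵐ ω ∂(BayesCV.dataLaw M π),
      BayesCV.postCC M π ω =
        (κ / n₀) • Matrix.of (fun l k => (BayesCV.blockCC V₀ l k).trace)
          + (1 - κ) • BayesCV.empCC ω.1) := by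
  subst hπ hκ
  have hCC := BayesCV.postCC_ae_eq (M := M) hn₀ hproper
  have hCh := BayesCV.postCh_ae_eq (M := M) hn₀ hproper
  refine ⟨BayesCV.isProbabilityMeasure_prior hproper,
    BayesCV.isProbabilityMeasure_dataLaw hproper, fun l k => ?_, fun l => ?_, ?_,
    ⟨_, BayesCV.isOptimalRule_bayesRule hd hn₀ hproper⟩, fun δ hδ => ?_, ?_, ?_⟩
  · simp only [BayesCV.transpose_mul_apply_eq]
    exact integrable_finsetSum _ fun i _ => BayesCV.integrable_mul_dataLaw hn₀ hproper _ _
  · simp only [BayesCV.transpose_mulVec_apply_eq]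
    exact integrable_finsetSum _ fun i _ => BayesCV.integrable_mul_dataLaw hn₀ hproper _ _
  · filter_upwards [hCC] with ω h
    rw [h]
    exact (BayesCV.posDef_meanCC ω.1 hd hn₀ hproper).det_pos.ne'.isUnit
  · rw [BayesCV.isOptimalRule_iff hd hn₀ hproper hδ]
    refine Filter.eventually_congr ?_
    filter_upwards [hCC, hCh] with ω h1 h2
    rw [h1, h2, BayesCV.bayesRule]
  · filter_upwards [hCh] with ω h
    rw [h, BayesCV.meanCh_eq ω.1 hn₀ hV₀]
  · filter_upwards [hCC] with ω h
    rw [h, BayesCV.meanCC_eq ω.1 hn₀ hV₀]
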